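/- **Theorem (Non-local generalized contracted Bianchi identities).** Let $\Omega\subseteq\mathbb{R}^4$ be open (a coordinate region of a 4-dimensional spacetime, with coordinates $x^0=t,x^1,x^2,x^3$), and let $g_{\mu\nu}$ be a smooth Lorentzian metric on $\Omega$ with inverse $g^{\mu\nu}$, Levi-Civita connection $\nabla$, Ricci tensor $R_{\mu\nu}=R^{\alpha}{}_{\mu\alpha\nu}$ (where $[\nabla_\mu,\nabla_\nu]A^\gamma=R^\gamma{}_{\lambda\mu\nu}A^\lambda$), scalar curvature $R$, Einstein tensor $G_{\mu\nu}=R_{\mu\nu}-\tfrac12 g_{\mu\nu}R$ and d'Alembert operator $$\Box=\nabla^\mu\nabla_\mu=\frac{1}{\sqrt{-g}}\,\partial_\sigma\bigl(\sqrt{-g}\,g^{\sigma\lambda}\partial_\lambda\bigr).$$ Let $G(x,x')$ be a retarded Green function of $\Box$ on $\Omega$: for every $x'\in\Omega$, $G(\cdot,x')$ is a distribution on $\Omega$ with $\sqrt{-g(x)}\,\Box_xG(x,x')=\delta^4(x-x')$ and $G(x,x')=0$ for $t<t'$. For a function $p$ on $\Omega$ write $u=\Box^{-1}p$ if $u$ is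 a smooth function on $\Omega$ and $$u(x)=\int_\Omega d^4x'\,\sqrt{-g(x')}\,G(x,x')\,p(x')$$ in the sense of distributions in $x$; that is, for every test function $h\in C_c^\infty(\Omega)$, with $\langle\cdot,\cdot\rangle$ the distributional pairing in $d^4x$, the function $x'\mapsto\sqrt{-g(x')}\,\langle G(\cdot,x'),h\rangle\,p(x')$ is integrable on $\Omega$ and its integral equals $\int_\Omega u\,h\,d^4x$. Suppose that $\Box^{-1}R$ exists in this sense, that $f$ is a real function which is analytic at every value of $\Box^{-1}R$ on $\Omega$, and that $\Box^{-1}[Rf']$ exists, where $f=f(\Box^{-1}R)$ and $f'=f'(\Box^{-1}R)$. Let $$\Delta G_{\mu\nu}=\bigl(G_{\mu\nu}+g_{\mu\nu}\Box-\nabla_\mu\nabla_\nu\bigr)\bigl[f+\Box^{-1}[Rf']\bigr]+\Bigl[\delta_\mu^{(\sigma}\delta_\nu^{\lambda)}-\tfrac12 g_{\mu\nu}g^{\sigma\lambda}\Bigr]\partial_\sigma\bigl(\Box^{-1}[Rf']\bigr)\,\partial_\lambda\bigl(\Box^{-1}R\bigr),$$ with $\delta_\mu^{(\sigma}\delta_\nu^{\lambda)}=\tfrac12(\delta_\mu^\sigma\delta_\nu^\lambda+\delta_\mu^\lambda\delta_\nu^\sigma)$;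 this is the correction to the Einstein tensor in the field equations of the action $\frac1{2\chi}\int d^4x\,\sqrt{-g}\,\bigl(R+Rf(\Box^{-1}R)\bigr)$. Then on $\Omega$ $$\nabla^\mu\bigl(G_{\mu\nu}+\Delta G_{\mu\nu}\bigr)=0 .$$ Consequently, if a tensor field $T_{\mu\nu}$ (in particular the energy-momentum tensor of matter) satisfies the field equations $G_{\mu\nu}+\Delta G_{\mu\nu}=\chi T_{\mu\nu}$ on $\Omega$ with a constant $\chi\neq0$, then $\nabla_\mu T^{\mu\nu}=0$ on $\Omega$. -/

import Mathlib

open TopologicalSpace MeasureTheory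
open scoped Distributions ContDiff Topology

namespace NonlocalGravity

noncomputable section

/-- Coordinates `(x⁰, x¹, x², x³)` on `ℝ⁴`; `x⁰ = t` is the time coordinate. -/
abbrev Coord : Type := Fin 4 → ℝ

/-- The partial derivative `∂_μ F`. -/
def pd (μ : Fin 4) (F : Coord → ℝ) (x : Coord) : ℝ :=
  fderiv ℝ F x (Pi.single μ 1)

/-- A smooth Lorentzian metric on the coordinate region `Ω ⊆ ℝ⁴`, given by its components
`g_{μν}`.  Both signature conventions `(-,+,+,+)` and `(+,-,-,-)` are admitted. -/
structure LorentzMetric (Ω : Opens Coord) where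
  /-- the components `g_{μν}(x)` -/
  comp : Coord → Matrix (Fin 4) (Fin 4) ℝ
  smooth : ∀ μ ν, ContDiffOn ℝ ∞ (fun x => comp x μ ν) Ω
  symm : ∀ x ∈ Ω, (comp x).IsSymm
  lorentzian : ∀ x ∈ Ω, ∃ P : Matrix (Fin 4) (Fin 4) ℝ, IsUnit P.det ∧
    (P.transpose * comp x * P = Matrix.diagonal ![-1, 1, 1, 1] ∨
      P.transpose * comp x * P = Matrix.diagonal ![1, -1, -1, -1])

namespace LorentzMetric

variable {Ω : Opens Coord} (g : LorentzMetric Ω)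

/-- `g_{μν}` -/
def lo (μ ν : Fin 4) (x : Coord) : ℝ := g.comp x μ ν

/-- the inverse metric `g^{μν}` -/
def up (μ ν : Fin 4) (x : Coord) : ℝ := (g.comp x)⁻¹ μ ν

/-- `√(-g)`, where `g` is the determinant of the metric -/
def sqrtNegDet (x : Coord) : ℝ := Real.sqrt (-(g.comp x).det)

/-- Christoffel symbols `Γ^γ_{μν}` of the Levi-Civita connection -/
def christoffel (γ μ ν : Fin 4) (x : Coord) : ℝ :=
  ∑ l, (1 / 2) * g.up γ l x * (pd μ (g.lo l ν) x + pd ν (g.lo l μ) x - pd l (g.lo μ ν) x)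

/-- Riemann tensor `R^γ_{λμν}`, with `[∇_μ, ∇_ν] A^γ = R^γ_{λμν} A^λ` -/
def riemann (γ l μ ν : Fin 4) (x : Coord) : ℝ :=
  pd μ (g.christoffel γ ν l) x - pd ν (g.christoffel γ μ l) x
    + ∑ a, (g.christoffel γ μ a x * g.christoffel a ν l x
        - g.christoffel γ ν a x * g.christoffel a μ l x)

/-- Ricci tensor `R_{μν} = R^a_{μaν}` -/
def ricci (μ ν : Fin 4) (x : Coord) : ℝ := ∑ a, g.riemann a μ a ν x

/-- scalar curvature `R = g^{μν} R_{μν}` -/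
def scalarCurv (x : Coord) : ℝ := ∑ μ, ∑ ν, g.up μ ν x * g.ricci μ ν x

/-- Einstein tensor `G_{μν} = R_{μν} - ½ g_{μν} R` -/
def einstein (μ ν : Fin 4) (x : Coord) : ℝ :=
  g.ricci μ ν x - (1 / 2) * g.lo μ ν x * g.scalarCurv x

/-- d'Alembert operator `□F = (1/√(-g)) ∂_σ (√(-g) g^{σλ} ∂_λ F)` -/
def box (F : Coord → ℝ) (x : Coord) : ℝ :=
  (g.sqrtNegDet x)⁻¹ *
    ∑ σ, pd σ (fun y => g.sqrtNegDet y * ∑ l, g.up σ l y * pd l F y) x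

/-- second covariant derivative of a function, `∇_μ ∇_ν F = ∂_μ ∂_ν F - Γ^λ_{μν} ∂_λ F` -/
def hess (μ ν : Fin 4) (F : Coord → ℝ) (x : Coord) : ℝ :=
  pd μ (pd ν F) x - ∑ l, g.christoffel l μ ν x * pd l F x

/-- covariant derivative `∇_α S_{μν}` of a twice covariant tensor field -/
def covDerivLower (S : Fin 4 → Fin 4 → Coord → ℝ) (α μ ν : Fin 4) (x : Coord) : ℝ :=
  pd α (S μ ν) x - ∑ β, g.christoffel β α μ x * S β ν x - ∑ β, g.christoffel β α ν x * S μ β x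

/-- covariant divergence `∇^μ S_{μν} = g^{μα} ∇_α S_{μν}` -/
def divLower (S : Fin 4 → Fin 4 → Coord → ℝ) (ν : Fin 4) (x : Coord) : ℝ :=
  ∑ μ, ∑ α, g.up μ α x * g.covDerivLower S α μ ν x

/-- raising both indices, `S^{μν} = g^{μα} g^{νβ} S_{αβ}` -/
def raise (S : Fin 4 → Fin 4 → Coord → ℝ) (μ ν : Fin 4) (x : Coord) : ℝ :=
  ∑ α, ∑ β, g.up μ α x * g.up ν β x * S α β x

/-- covariant derivative `∇_α A^{μν}` of a twice contravariant tensor field -/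
def covDerivUpper (A : Fin 4 → Fin 4 → Coord → ℝ) (α μ ν : Fin 4) (x : Coord) : ℝ :=
  pd α (A μ ν) x + ∑ β, g.christoffel μ α β x * A β ν x + ∑ β, g.christoffel ν α β x * A μ β x

/-- covariant divergence `∇_μ A^{μν}` -/
def divUpper (A : Fin 4 → Fin 4 → Coord → ℝ) (ν : Fin 4) (x : Coord) : ℝ :=
  ∑ μ, g.covDerivUpper A μ μ ν x

/-! ### `√(-g) □` maps test functions to test functions -/

theorem det_neg {x : Coord} (hx : x ∈ Ω) : (g.comp x).det < 0 := by
  obtain ⟨P, hP, h⟩ := g.lorentzian x hx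
  have hP0 : P.det ≠ 0 := hP.ne_zero
  have key : P.det ^ 2 * (g.comp x).det = -1 := by
    rcases h with h | h <;>
    · have h2 := congrArg Matrix.det h
      rw [Matrix.det_mul, Matrix.det_mul, Matrix.det_transpose, Matrix.det_diagonal] at h2
      simp [Fin.prod_univ_four] at h2
      linarith
  have : 0 < P.det ^ 2 := by positivity
  by_contra hc
  push Not at hc
  nlinarith [mul_nonneg this.le hc]

theorem contDiffOn_det : ContDiffOn ℝ ∞ (fun x => (g.comp x).det) Ω := by
  simp only [Matrix.det_apply]
  refine ContDiffOn.sum fun s _ => ?_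
  refine ContDiffOn.const_smul _ ?_
  exact contDiffOn_prod fun i _ => g.smooth _ _

theorem contDiffOn_sqrtNegDet : ContDiffOn ℝ ∞ g.sqrtNegDet Ω :=
  g.contDiffOn_det.neg.sqrt fun x hx => by
    have := g.det_neg hx
    linarith

theorem contDiffOn_up (μ ν : Fin 4) : ContDiffOn ℝ ∞ (g.up μ ν) Ω := by
  have h1 : ContDiffOn ℝ ∞ (fun x => (g.comp x).adjugate μ ν) Ω := by
    simp only [Matrix.adjugate_apply, Matrix.det_apply]
    refine ContDiffOn.sum fun s _ => ?_
    refine ContDiffOn.const_smul _ ?_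
    refine contDiffOn_prod fun i _ => ?_
    by_cases h : s i = ν
    · simpa [Matrix.updateRow_apply, h] using contDiffOn_const
    · simpa [Matrix.updateRow_apply, h] using g.smooth _ _
  have h2 : ContDiffOn ℝ ∞ (fun x => ((g.comp x).det)⁻¹ * (g.comp x).adjugate μ ν) Ω :=
    (g.contDiffOn_det.inv fun x hx => (g.det_neg hx).ne).mul h1
  refine h2.congr fun x _ => ?_
  simp [up, Matrix.inv_def]

theorem contDiffOn_pd (μ : Fin 4) {F : Coord → ℝ} (hF : ContDiffOn ℝ ∞ F Ω) :
    ContDiffOn ℝ ∞ (pd μ F) Ω :=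
  (hF.fderiv_of_isOpen Ω.isOpen (by simp)).clm_apply contDiffOn_const

theorem contDiffOn_box {F : Coord → ℝ} (hF : ContDiffOn ℝ ∞ F Ω) :
    ContDiffOn ℝ ∞ (g.box F) Ω := by
  refine (g.contDiffOn_sqrtNegDet.inv fun x hx => ?_).mul (ContDiffOn.sum fun σ _ => ?_)
  · have := g.det_neg hx
    exact (Real.sqrt_pos.2 (by linarith)).ne'
  · exact contDiffOn_pd σ (g.contDiffOn_sqrtNegDet.mul
      (ContDiffOn.sum fun l _ => (g.contDiffOn_up σ l).mul (contDiffOn_pd l hF)))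

theorem pd_eq_zero {μ : Fin 4} {F : Coord → ℝ} {x : Coord} (h : F =ᶠ[𝓝 x] 0) :
    pd μ F x = 0 := by
  simp [pd, h.fderiv_eq]

theorem box_eq_zero {F : Coord → ℝ} {x : Coord} (h : F =ᶠ[𝓝 x] 0) : g.box F x = 0 := by
  have h2 : ∀ σ, pd σ (fun y => g.sqrtNegDet y * ∑ l, g.up σ l y * pd l F y) x = 0 := by
    intro σ
    refine pd_eq_zero ?_
    filter_upwards [h.eventuallyEq_nhds] with y hy
    simp [pd_eq_zero hy]
  simp [box, h2]

theorem tsupport_box_subset (h : 𝓓(Ω, ℝ)) :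
    tsupport (fun x => g.sqrtNegDet x * g.box h x) ⊆ tsupport h := by
  refine closure_minimal (fun x hx => ?_) (isClosed_tsupport _)
  by_contra hc
  exact hx (by simp [g.box_eq_zero (notMem_tsupport_iff_eventuallyEq.1 hc)])

/-- The test function `√(-g) □h`.  The operator `√(-g) □ = ∂_σ √(-g) g^{σλ} ∂_λ` is its own formal
transpose with respect to `d⁴x`, so `⟨√(-g) □G, h⟩ = ⟨G, √(-g) □h⟩` for a distribution `G`. -/
def boxTest (h : 𝓓(Ω, ℝ)) : 𝓓(Ω, ℝ) where
  toFun x := g.sqrtNegDet x * g.box h x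
  contDiff' := by
    refine contDiff_iff_contDiffAt.2 fun x => ?_
    by_cases hx : x ∈ tsupport h
    · have hΩ : (Ω : Set Coord) ∈ 𝓝 x := Ω.isOpen.mem_nhds (h.tsupport_subset hx)
      exact (g.contDiffOn_sqrtNegDet.mul (g.contDiffOn_box h.contDiff.contDiffOn)).contDiffAt hΩ
    · have h0 := notMem_tsupport_iff_eventuallyEq.1 hx
      refine (contDiffAt_const (c := (0 : ℝ))).congr_of_eventuallyEq ?_
      filter_upwards [h0.eventuallyEq_nhds] with y hy
      simp [g.box_eq_zero hy]
  hasCompactSupport' :=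
    h.hasCompactSupport.of_isClosed_subset (isClosed_tsupport _) (g.tsupport_box_subset h)
  tsupport_subset' := (g.tsupport_box_subset h).trans h.tsupport_subset

/-- `G` is a retarded Green function of `□` on `Ω`: for every source point `x'`, the distribution
`G x' = G(·, x')` satisfies `√(-g(x)) □_x G(x, x') = δ⁴(x - x')` and vanishes where `t < t'`.
Distributions are paired with test functions through `d⁴x`. -/
structure IsRetardedGreen (G : Coord → 𝓓'(Ω, ℝ)) : Prop where
  green : ∀ x' ∈ Ω, ∀ h : 𝓓(Ω, ℝ), G x' (g.boxTest h) = (Distribution.delta x' : 𝓓'(Ω, ℝ)) h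
  retarded : ∀ x' ∈ Ω, ∀ h : 𝓓(Ω, ℝ), (∀ x ∈ tsupport h, x 0 < x' 0) → G x' h = 0

/-- `u = □⁻¹ p` on `Ω`: `u` is smooth and
`u(x) = ∫_Ω d⁴x' √(-g(x')) G(x, x') p(x')`, where, `G(·, x')` being a distribution, the integral is
understood weakly, that is, after pairing both sides with an arbitrary test function `h(x) d⁴x`. -/
structure IsBoxInv (G : Coord → 𝓓'(Ω, ℝ)) (p u : Coord → ℝ) : Prop where
  smooth : ContDiffOn ℝ ∞ u Ω
  integrable : ∀ h : 𝓓(Ω, ℝ),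
    IntegrableOn (fun x' => g.sqrtNegDet x' * G x' h * p x') Ω
  eq_integral : ∀ h : 𝓓(Ω, ℝ),
    ∫ x in Ω, u x * h x = ∫ x' in Ω, g.sqrtNegDet x' * G x' h * p x'

/-- The non-local correction, as a function of `f`, `U = □⁻¹R` and `V = □⁻¹[R f'(□⁻¹R)]`:
`ΔG_{μν} = (G_{μν} + g_{μν} □ - ∇_μ ∇_ν) [f(U) + V]
  + [δ_μ^{(σ} δ_ν^{λ)} - ½ g_{μν} g^{σλ}] ∂_σ V ∂_λ U`. -/
def deltaG (f : ℝ → ℝ) (U V : Coord → ℝ) (μ ν : Fin 4) (x : Coord) : ℝ :=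
  g.einstein μ ν x * (f (U x) + V x)
    + g.lo μ ν x * g.box (fun y => f (U y) + V y) x
    - g.hess μ ν (fun y => f (U y) + V y) x
    + ∑ σ, ∑ l,
        ((1 / 2) * ((if σ = μ then 1 else 0) * (if l = ν then 1 else 0)
            + (if l = μ then 1 else 0) * (if σ = ν then 1 else 0))
          - (1 / 2) * g.lo μ ν x * g.up σ l x) * pd σ V x * pd l U x

end LorentzMetric

end

end NonlocalGravity

/-! The non-locality disappears once the two inverse d'Alembertians are inverted. With U = □⁻¹R and
V = □⁻¹[Rf'(U)], pairing the defining integral with √(-g)□h, integrating by parts and using the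
Green equation gives □U = R and □V = Rf'(U) pointwise (`IsBoxInv.box_eq`). The rest is local tensor
calculus for the smooth functions U, V and F = f(U) + V.

Two divergences carry the result. First, ∇^μ(G_{μν} + g_{μν}□ - ∇_μ∇_ν)F = -½ R ∂_νF
(`divLower_einstein_operator`): since ∇^μG_{μν} = 0, the Einstein term leaves G^μ_ν ∂_μF, the Ricci
identity gives ∇^μ∇_μ∇_νF = ∂_ν□F + R^μ_ν ∂_μF, and only the trace part of G^μ_ν survives. Second,
the bilinear term in ∂V and ∂U behaves like the stress tensor of two scalar fields, with divergence
½(□V ∂_νU + □U ∂_νV) (`divLower_stress`). Inserting the two equations for U and V and ∂_νF =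
f'(U)∂_νU + ∂_νV, the sum is zero.

The contracted Bianchi identity is proved from the coordinate definitions. Connection and curvature
are treated as matrices, R_{μν} = ∂_μΓ_ν - ∂_νΓ_μ + [Γ_μ, Γ_ν], so that the Bianchi identity and the
antisymmetry of R^{γλ}_{μν} in γλ become noncommutative polynomial identities modulo commuting
partial derivatives. -/

namespace NonlocalGravity

/-! ### Calculus of partial derivatives, for functions and entrywise for matrix fields. -/

variable {Ω : Opens Coord}

theorem differentiableAt_of_smooth {F : Coord → ℝ} (hF : ContDiffOn ℝ ∞ F Ω) {x : Coord}
    (hx : x ∈ Ω) : DifferentiableAt ℝ F x :=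
  (hF.contDiffAt (Ω.isOpen.mem_nhds hx)).differentiableAt (by simp)

theorem pd_congr {F H : Coord → ℝ} (h : ∀ y ∈ Ω, F y = H y) {x : Coord} (hx : x ∈ Ω)
    (μ : Fin 4) : pd μ F x = pd μ H x := by
  have : F =ᶠ[𝓝 x] H := Filter.eventuallyEq_of_mem (Ω.isOpen.mem_nhds hx) h
  simp only [pd, this.fderiv_eq]

theorem pd_const (μ : Fin 4) (c : ℝ) (x : Coord) : pd μ (fun _ => c) x = 0 := by
  simp [pd]

theorem pd_neg (μ : Fin 4) (F : Coord → ℝ) (x : Coord) :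
    pd μ (fun y => - F y) x = - pd μ F x := by
  simp [pd, fderiv_fun_neg]

theorem pd_add {F H : Coord → ℝ} {x : Coord} (hF : DifferentiableAt ℝ F x)
    (hH : DifferentiableAt ℝ H x) (μ : Fin 4) :
    pd μ (fun y => F y + H y) x = pd μ F x + pd μ H x := by
  simp [pd, fderiv_fun_add hF hH]

theorem pd_sub {F H : Coord → ℝ} {x : Coord} (hF : DifferentiableAt ℝ F x)
    (hH : DifferentiableAt ℝ H x) (μ : Fin 4) :
    pd μ (fun y => F y - H y) x = pd μ F x - pd μ H x := by
  simp [pd, fderiv_fun_sub hF hH]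

theorem pd_mul {F H : Coord → ℝ} {x : Coord} (hF : DifferentiableAt ℝ F x)
    (hH : DifferentiableAt ℝ H x) (μ : Fin 4) :
    pd μ (fun y => F y * H y) x = pd μ F x * H x + F x * pd μ H x := by
  simp [pd, fderiv_fun_mul hF hH]
  ring

theorem pd_const_mul {F : Coord → ℝ} {x : Coord} (hF : DifferentiableAt ℝ F x) (c : ℝ)
    (μ : Fin 4) : pd μ (fun y => c * F y) x = c * pd μ F x := by
  rw [pd_mul (differentiableAt_const c) hF, pd_const]
  ring

theorem pd_sum {ι : Type*} {s : Finset ι} {F : ι → Coord → ℝ} {x : Coord}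
    (hF : ∀ i ∈ s, DifferentiableAt ℝ (F i) x) (μ : Fin 4) :
    pd μ (fun y => ∑ i ∈ s, F i y) x = ∑ i ∈ s, pd μ (F i) x := by
  simp [pd, fderiv_fun_sum hF]

theorem pd_comp {f : ℝ → ℝ} {F : Coord → ℝ} {x : Coord} (hf : DifferentiableAt ℝ f (F x))
    (hF : DifferentiableAt ℝ F x) (μ : Fin 4) :
    pd μ (fun y => f (F y)) x = deriv f (F x) * pd μ F x := by
  have := (hf.hasDerivAt.comp_hasFDerivAt x hF.hasFDerivAt).fderiv
  simp only [pd]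
  rw [show (fun y => f (F y)) = f ∘ F from rfl, this]
  simp

theorem pd_comm {F : Coord → ℝ} (hF : ContDiffOn ℝ ∞ F Ω) {x : Coord} (hx : x ∈ Ω)
    (μ ν : Fin 4) : pd μ (pd ν F) x = pd ν (pd μ F) x := by
  have hc := hF.contDiffAt (Ω.isOpen.mem_nhds hx)
  have hs : IsSymmSndFDerivAt ℝ F x := hc.isSymmSndFDerivAt (by simpa using WithTop.coe_le_coe.2 (le_top (a := (2 : ℕ∞))))
  have hd : DifferentiableAt ℝ (fderiv ℝ F) x :=
    (hc.fderiv_right (m := 1) (by norm_cast)).differentiableAt (by simp)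
  have key (a b : Fin 4) : pd a (pd b F) x =
      fderiv ℝ (fderiv ℝ F) x (Pi.single a 1) (Pi.single b 1) := by
    change fderiv ℝ (fun y => fderiv ℝ F y (Pi.single b 1)) x (Pi.single a 1) = _
    rw [fderiv_clm_apply hd (differentiableAt_const _)]
    simp
  rw [key, key, hs.eq]

/-- Smoothness on `Ω` of all entries of a matrix-valued function. -/
def SmoothMat (Ω : Opens Coord) (A : Coord → Matrix (Fin 4) (Fin 4) ℝ) : Prop :=
  ∀ i j, ContDiffOn ℝ ∞ (fun y => A y i j) Ω

/-- The entrywise partial derivative of a matrix-valued function. -/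
noncomputable def mpd (μ : Fin 4) (A : Coord → Matrix (Fin 4) (Fin 4) ℝ) (x : Coord) :
    Matrix (Fin 4) (Fin 4) ℝ :=
  Matrix.of fun i j => pd μ (fun y => A y i j) x

namespace SmoothMat

variable {A B : Coord → Matrix (Fin 4) (Fin 4) ℝ}

theorem add (hA : SmoothMat Ω A) (hB : SmoothMat Ω B) : SmoothMat Ω (fun y => A y + B y) :=
  fun i j => (hA i j).add (hB i j)

theorem sub (hA : SmoothMat Ω A) (hB : SmoothMat Ω B) : SmoothMat Ω (fun y => A y - B y) :=
  fun i j => (hA i j).sub (hB i j)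

theorem transpose (hA : SmoothMat Ω A) : SmoothMat Ω (fun y => (A y).transpose) :=
  fun i j => hA j i

theorem mul (hA : SmoothMat Ω A) (hB : SmoothMat Ω B) : SmoothMat Ω (fun y => A y * B y) := by
  intro i j
  simp only [Matrix.mul_apply]
  exact ContDiffOn.sum fun k _ => (hA i k).mul (hB k j)

theorem mpd (hA : SmoothMat Ω A) (μ : Fin 4) : SmoothMat Ω (mpd μ A) :=
  fun i j => LorentzMetric.contDiffOn_pd μ (hA i j)

theorem differentiableAt (hA : SmoothMat Ω A) {x : Coord} (hx : x ∈ Ω) (i j : Fin 4) :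
    DifferentiableAt ℝ (fun y => A y i j) x :=
  differentiableAt_of_smooth (hA i j) hx

end SmoothMat

section mpd

variable {A B : Coord → Matrix (Fin 4) (Fin 4) ℝ} {x : Coord}

theorem mpd_congr (h : ∀ y ∈ Ω, A y = B y) (hx : x ∈ Ω) (μ : Fin 4) :
    mpd μ A x = mpd μ B x := by
  ext i j
  exact pd_congr (fun y hy => by rw [h y hy]) hx μ

theorem mpd_const (C : Matrix (Fin 4) (Fin 4) ℝ) (μ : Fin 4) : mpd μ (fun _ => C) x = 0 := by
  ext i j
  exact pd_const _ _ _

theorem mpd_add (hA : SmoothMat Ω A) (hB : SmoothMat Ω B) (hx : x ∈ Ω) (μ : Fin 4) :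
    mpd μ (fun y => A y + B y) x = mpd μ A x + mpd μ B x := by
  ext i j
  exact pd_add (hA.differentiableAt hx i j) (hB.differentiableAt hx i j) μ

theorem mpd_sub (hA : SmoothMat Ω A) (hB : SmoothMat Ω B) (hx : x ∈ Ω) (μ : Fin 4) :
    mpd μ (fun y => A y - B y) x = mpd μ A x - mpd μ B x := by
  ext i j
  exact pd_sub (hA.differentiableAt hx i j) (hB.differentiableAt hx i j) μ

theorem mpd_neg (μ : Fin 4) : mpd μ (fun y => - A y) x = - mpd μ A x := by
  ext i j
  exact pd_neg _ _ _

theorem mpd_transpose (μ : Fin 4) :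
    mpd μ (fun y => (A y).transpose) x = (mpd μ A x).transpose :=
  rfl

theorem mpd_mul (hA : SmoothMat Ω A) (hB : SmoothMat Ω B) (hx : x ∈ Ω) (μ : Fin 4) :
    mpd μ (fun y => A y * B y) x = mpd μ A x * B x + A x * mpd μ B x := by
  ext i j
  simp only [mpd, Matrix.of_apply, Matrix.add_apply, Matrix.mul_apply]
  rw [pd_sum fun k _ => (hA.differentiableAt hx i k).fun_mul (hB.differentiableAt hx k j),
    ← Finset.sum_add_distrib]
  exact Finset.sum_congr rfl fun k _ =>
    pd_mul (hA.differentiableAt hx i k) (hB.differentiableAt hx k j) μ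

theorem mpd_comm (hA : SmoothMat Ω A) (hx : x ∈ Ω) (μ ν : Fin 4) :
    mpd μ (mpd ν A) x = mpd ν (mpd μ A) x := by
  ext i j
  exact pd_comm (hA i j) hx μ ν

end mpd

/-! ### Metric compatibility, symmetries of the curvature and the Bianchi identity in matrix form.
-/

namespace LorentzMetric

variable {Ω : Opens Coord} (g : LorentzMetric Ω) {x : Coord}

/-- The inverse metric as a matrix-valued function. -/
noncomputable def inv (x : Coord) : Matrix (Fin 4) (Fin 4) ℝ := (g.comp x)⁻¹

/-- The connection matrices `(Γ_μ)^γ_λ = Γ^γ_{μλ}`. -/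
noncomputable def conn (μ : Fin 4) (x : Coord) : Matrix (Fin 4) (Fin 4) ℝ :=
  Matrix.of fun γ l => g.christoffel γ μ l x

/-- The curvature matrices `(R_{μν})^γ_λ = R^γ_{λμν}`. -/
noncomputable def curv (μ ν : Fin 4) (x : Coord) : Matrix (Fin 4) (Fin 4) ℝ :=
  Matrix.of fun γ l => g.riemann γ l μ ν x

/-- The curvature with second index raised, `(K_{μν})^{γλ} = R^{γλ}_{μν}`. -/
noncomputable def curvUp (μ ν : Fin 4) (x : Coord) : Matrix (Fin 4) (Fin 4) ℝ :=
  g.curv μ ν x * g.inv x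

theorem isUnit_det (hx : x ∈ Ω) : IsUnit (g.comp x).det := (g.det_neg hx).ne.isUnit

theorem inv_mul_comp (hx : x ∈ Ω) : g.inv x * g.comp x = 1 :=
  Matrix.nonsing_inv_mul _ (g.isUnit_det hx)

theorem comp_mul_inv (hx : x ∈ Ω) : g.comp x * g.inv x = 1 :=
  Matrix.mul_nonsing_inv _ (g.isUnit_det hx)

theorem lo_symm (hx : x ∈ Ω) (μ ν : Fin 4) : g.lo μ ν x = g.lo ν μ x :=
  (g.symm x hx).apply ν μ

theorem inv_transpose (hx : x ∈ Ω) : (g.inv x).transpose = g.inv x := by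
  rw [inv, Matrix.transpose_nonsing_inv, g.symm x hx]

theorem up_symm (hx : x ∈ Ω) (μ ν : Fin 4) : g.up μ ν x = g.up ν μ x :=
  congrFun (congrFun (g.inv_transpose hx) ν) μ

theorem pd_lo_symm (hx : x ∈ Ω) (l μ ν : Fin 4) : pd l (g.lo μ ν) x = pd l (g.lo ν μ) x :=
  pd_congr (fun _ hy => g.lo_symm hy μ ν) hx l

theorem christoffel_symm (hx : x ∈ Ω) (γ μ ν : Fin 4) :
    g.christoffel γ μ ν x = g.christoffel γ ν μ x := by
  simp only [christoffel]
  refine Finset.sum_congr rfl fun l _ => ?_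
  rw [g.pd_lo_symm hx l μ ν]
  ring

theorem contDiffOn_lo (μ ν : Fin 4) : ContDiffOn ℝ ∞ (g.lo μ ν) Ω := g.smooth μ ν

theorem contDiffOn_christoffel (γ μ ν : Fin 4) : ContDiffOn ℝ ∞ (g.christoffel γ μ ν) Ω :=
  ContDiffOn.sum fun l _ => (contDiffOn_const.mul (g.contDiffOn_up γ l)).mul
    (((contDiffOn_pd μ (g.contDiffOn_lo l ν)).add (contDiffOn_pd ν (g.contDiffOn_lo l μ))).sub
      (contDiffOn_pd l (g.contDiffOn_lo μ ν)))

theorem smoothMat_comp : SmoothMat Ω g.comp := g.smooth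

theorem smoothMat_inv : SmoothMat Ω g.inv := g.contDiffOn_up

theorem smoothMat_conn (μ : Fin 4) : SmoothMat Ω (g.conn μ) :=
  fun γ l => g.contDiffOn_christoffel γ μ l

theorem curv_eq (μ ν : Fin 4) (x : Coord) :
    g.curv μ ν x = mpd μ (g.conn ν) x - mpd ν (g.conn μ) x
      + (g.conn μ x * g.conn ν x - g.conn ν x * g.conn μ x) := by
  ext γ l
  simp only [curv, riemann, mpd, conn, Matrix.of_apply, Matrix.add_apply, Matrix.sub_apply,
    Matrix.mul_apply, Finset.sum_sub_distrib]

theorem curv_antisymm (μ ν : Fin 4) (x : Coord) : g.curv μ ν x = - g.curv ν μ x := by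
  rw [curv_eq, curv_eq]
  abel

theorem smoothMat_curv (μ ν : Fin 4) : SmoothMat Ω (g.curv μ ν) := by
  rw [show g.curv μ ν = _ from funext (g.curv_eq μ ν)]
  exact (((g.smoothMat_conn ν).mpd μ).sub ((g.smoothMat_conn μ).mpd ν)).add
    (((g.smoothMat_conn μ).mul (g.smoothMat_conn ν)).sub
      ((g.smoothMat_conn ν).mul (g.smoothMat_conn μ)))

theorem smoothMat_curvUp (μ ν : Fin 4) : SmoothMat Ω (g.curvUp μ ν) :=
  (g.smoothMat_curv μ ν).mul g.smoothMat_inv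

/-- Christoffel symbols with lowered index. -/
theorem sum_lo_mul_christoffel (hx : x ∈ Ω) (α μ β : Fin 4) :
    ∑ γ, g.lo α γ x * g.christoffel γ μ β x =
      (1 / 2) * (pd μ (g.lo α β) x + pd β (g.lo α μ) x - pd α (g.lo μ β) x) := by
  have h1 (l : Fin 4) : ∑ γ, g.lo α γ x * g.up γ l x = if α = l then 1 else 0 := by
    have := congrFun (congrFun (g.comp_mul_inv hx) α) l
    rw [Matrix.mul_apply, Matrix.one_apply] at this
    exact this
  simp only [christoffel, Finset.mul_sum]
  rw [Finset.sum_comm]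
  have h2 (l : Fin 4) : ∑ γ, g.lo α γ x * (1 / 2 * g.up γ l x *
      (pd μ (g.lo l β) x + pd β (g.lo l μ) x - pd l (g.lo μ β) x)) =
      if α = l then (1 / 2) * (pd μ (g.lo l β) x + pd β (g.lo l μ) x - pd l (g.lo μ β) x)
        else 0 := by
    have h3 := congrArg
      (· * ((1 / 2) * (pd μ (g.lo l β) x + pd β (g.lo l μ) x - pd l (g.lo μ β) x))) (h1 l)
    simp only [Finset.sum_mul, ite_mul, one_mul, zero_mul] at h3
    rw [← h3]
    exact Finset.sum_congr rfl fun γ _ => by ring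
  simp only [h2, Finset.sum_ite_eq, Finset.mem_univ, if_true]

/-- Metric compatibility of the Levi-Civita connection. -/
theorem mpd_comp (hx : x ∈ Ω) (μ : Fin 4) :
    mpd μ g.comp x = g.comp x * g.conn μ x + (g.conn μ x).transpose * g.comp x := by
  ext α β
  have h1 := g.sum_lo_mul_christoffel hx α μ β
  have h2 := g.sum_lo_mul_christoffel hx β μ α
  have h3 : ∑ γ, g.christoffel γ μ α x * g.lo γ β x = ∑ γ, g.lo β γ x * g.christoffel γ μ α x :=
    Finset.sum_congr rfl fun γ _ => by rw [g.lo_symm hx γ β, mul_comm]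
  rw [g.pd_lo_symm hx μ β α, g.pd_lo_symm hx α β μ, g.pd_lo_symm hx β μ α] at h2
  change pd μ (g.lo α β) x = ∑ γ, g.lo α γ x * g.christoffel γ μ β x +
    ∑ γ, g.christoffel γ μ α x * g.lo γ β x
  rw [h3, h1, h2]
  ring

/-- Differentiate g⁻¹g = 1, insert metric compatibility for ∂_μg, and multiply by g⁻¹ on the right.
This is ∇g⁻¹ = 0. -/
theorem mpd_inv (hx : x ∈ Ω) (μ : Fin 4) :
    mpd μ g.inv x = - (g.conn μ x * g.inv x + g.inv x * (g.conn μ x).transpose) := by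
  have h1 : mpd μ (fun y => g.inv y * g.comp y) x = 0 := by
    rw [mpd_congr (fun y hy => g.inv_mul_comp hy) hx, mpd_const]
  rw [mpd_mul g.smoothMat_inv g.smoothMat_comp hx, g.mpd_comp hx] at h1
  have h2 := congrArg (· * g.inv x) h1
  simp only [zero_mul, add_mul, mul_add, mul_assoc, g.comp_mul_inv hx, mul_one] at h2
  rw [← mul_assoc (g.inv x) (g.comp x), g.inv_mul_comp hx, one_mul] at h2
  rw [eq_neg_iff_add_eq_zero, ← h2]

/-- Antisymmetry of `R^{γλ}_{μν}` in the first pair of indices. -/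
theorem curvUp_transpose (hx : x ∈ Ω) (μ ν : Fin 4) :
    (g.curvUp μ ν x).transpose = - g.curvUp μ ν x := by
  -- Differentiating ∇g⁻¹ = 0 once more expresses ∂_a∂_b g⁻¹ through Γ and ∂Γ. Equality of the mixed
  -- partials then says that R_{μν}g⁻¹ + g⁻¹R_{μν}ᵀ = 0, which is the antisymmetry.
  have key (a b : Fin 4) : mpd a (mpd b g.inv) x =
      - (mpd a (g.conn b) x * g.inv x
        - g.conn b x * (g.conn a x * g.inv x + g.inv x * (g.conn a x).transpose)
        + (- (g.conn a x * g.inv x + g.inv x * (g.conn a x).transpose) * (g.conn b x).transpose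
        + g.inv x * (mpd a (g.conn b) x).transpose)) := by
    rw [mpd_congr (fun y hy => g.mpd_inv hy b) hx, mpd_neg,
      mpd_add ((g.smoothMat_conn b).mul g.smoothMat_inv)
        (g.smoothMat_inv.mul (g.smoothMat_conn b).transpose) hx,
      mpd_mul (g.smoothMat_conn b) g.smoothMat_inv hx,
      mpd_mul g.smoothMat_inv (g.smoothMat_conn b).transpose hx, mpd_transpose, g.mpd_inv hx]
    noncomm_ring
  have hc := mpd_comm g.smoothMat_inv hx μ ν
  rw [key, key, ← sub_eq_zero] at hc
  rw [eq_neg_iff_add_eq_zero, curvUp, Matrix.transpose_mul, g.inv_transpose hx, curv_eq]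
  simp only [Matrix.transpose_add, Matrix.transpose_sub, Matrix.transpose_mul]
  rw [← neg_eq_zero, ← hc]
  noncomm_ring

/-- The second Bianchi identity, without the terms that cancel because the connection is
torsion free. -/
theorem curv_bianchi (hx : x ∈ Ω) (α μ ν : Fin 4) :
    (mpd α (g.curv μ ν) x + (g.conn α x * g.curv μ ν x - g.curv μ ν x * g.conn α x))
    + (mpd μ (g.curv ν α) x + (g.conn μ x * g.curv ν α x - g.curv ν α x * g.conn μ x))
    + (mpd ν (g.curv α μ) x + (g.conn ν x * g.curv α μ x - g.curv α μ x * g.conn ν x)) = 0 := by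
  have key (a b c : Fin 4) : mpd a (g.curv b c) x =
      mpd a (mpd b (g.conn c)) x - mpd a (mpd c (g.conn b)) x
      + ((mpd a (g.conn b) x * g.conn c x + g.conn b x * mpd a (g.conn c) x)
        - (mpd a (g.conn c) x * g.conn b x + g.conn c x * mpd a (g.conn b) x)) := by
    have sm := g.smoothMat_conn
    rw [mpd_congr (fun y _ => g.curv_eq b c y) hx,
      mpd_add (((sm c).mpd b).sub ((sm b).mpd c))
        (((sm b).mul (sm c)).sub ((sm c).mul (sm b))) hx,
      mpd_sub ((sm c).mpd b) ((sm b).mpd c) hx,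
      mpd_sub ((sm b).mul (sm c)) ((sm c).mul (sm b)) hx,
      mpd_mul (sm b) (sm c) hx, mpd_mul (sm c) (sm b) hx]
  -- Once the second derivatives of Γ are matched in pairs, what remains is polynomial in Γ and ∂Γ;
  -- the cubic part is the Jacobi identity for the matrices Γ_α, Γ_μ, Γ_ν.
  rw [key, key, key, mpd_comm (g.smoothMat_conn ν) hx α μ, mpd_comm (g.smoothMat_conn μ) hx α ν,
    mpd_comm (g.smoothMat_conn α) hx μ ν]
  simp only [curv_eq]
  noncomm_ring

/-- The matrix Bianchi identity times g⁻¹ from the right: as ∇g⁻¹ = 0, the term -R_{μν}Γ_α acting on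
the lower index turns into an action of Γ_αᵀ on the raised one. -/
theorem curvUp_bianchi (hx : x ∈ Ω) (α μ ν : Fin 4) :
    (mpd α (g.curvUp μ ν) x + g.conn α x * g.curvUp μ ν x
      + g.curvUp μ ν x * (g.conn α x).transpose)
    + (mpd μ (g.curvUp ν α) x + g.conn μ x * g.curvUp ν α x
      + g.curvUp ν α x * (g.conn μ x).transpose)
    + (mpd ν (g.curvUp α μ) x + g.conn ν x * g.curvUp α μ x
      + g.curvUp α μ x * (g.conn ν x).transpose) = 0 := by
  have key (a b c : Fin 4) : mpd a (g.curvUp b c) x = mpd a (g.curv b c) x * g.inv x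
      - g.curv b c x * (g.conn a x * g.inv x + g.inv x * (g.conn a x).transpose) := by
    rw [mpd_congr (A := g.curvUp b c) (B := fun y => g.curv b c y * g.inv y) (fun _ _ => rfl) hx,
      mpd_mul (g.smoothMat_curv b c) g.smoothMat_inv hx, g.mpd_inv hx]
    noncomm_ring
  have h := congrArg (· * g.inv x) (g.curv_bianchi hx α μ ν)
  simp only [zero_mul] at h
  rw [key, key, key, ← h]
  simp only [curvUp]
  noncomm_ring

end LorentzMetric

/-! ### Divergence, raising of indices and the contracted Bianchi identity. -/

namespace LorentzMetric

variable {Ω : Opens Coord} (g : LorentzMetric Ω) {x : Coord}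

/-- Covariant divergence `∇_μ S^μ_ν` of a mixed tensor field. -/
noncomputable def divMixed (S : Fin 4 → Fin 4 → Coord → ℝ) (ν : Fin 4) (x : Coord) : ℝ :=
  ∑ μ, (pd μ (S μ ν) x + ∑ β, g.christoffel μ μ β x * S β ν x
    - ∑ β, g.christoffel β μ ν x * S μ β x)

/-- Raising the first index, `S^μ_ν = g^{μλ} S_{λν}`. -/
noncomputable def raiseFst (S : Fin 4 → Fin 4 → Coord → ℝ) (μ ν : Fin 4) (x : Coord) : ℝ :=
  ∑ l, g.up μ l x * S l ν x

theorem pd_up (hx : x ∈ Ω) (α μ ν : Fin 4) :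
    pd α (g.up μ ν) x = - (∑ β, g.christoffel μ α β x * g.up β ν x
      + ∑ β, g.up μ β x * g.christoffel ν α β x) := by
  have := congrFun (congrFun (g.mpd_inv hx α) μ) ν
  simp only [Matrix.neg_apply, Matrix.add_apply, Matrix.mul_apply] at this
  exact this

theorem divLower_congr {S T : Fin 4 → Fin 4 → Coord → ℝ}
    (h : ∀ y ∈ Ω, ∀ μ ν, S μ ν y = T μ ν y) (hx : x ∈ Ω) (ν : Fin 4) :
    g.divLower S ν x = g.divLower T ν x := by
  simp only [divLower, covDerivLower, h x hx]
  refine Finset.sum_congr rfl fun μ _ => Finset.sum_congr rfl fun α _ => ?_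
  rw [pd_congr (fun y hy => h y hy μ ν) hx α]

theorem divMixed_congr {S T : Fin 4 → Fin 4 → Coord → ℝ}
    (h : ∀ y ∈ Ω, ∀ μ ν, S μ ν y = T μ ν y) (hx : x ∈ Ω) (ν : Fin 4) :
    g.divMixed S ν x = g.divMixed T ν x := by
  simp only [divMixed, h x hx]
  refine Finset.sum_congr rfl fun μ _ => ?_
  rw [pd_congr (fun y hy => h y hy μ ν) hx μ]

theorem contDiffOn_raiseFst {S : Fin 4 → Fin 4 → Coord → ℝ}
    (hS : ∀ μ ν, ContDiffOn ℝ ∞ (S μ ν) Ω) (μ ν : Fin 4) :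
    ContDiffOn ℝ ∞ (g.raiseFst S μ ν) Ω :=
  ContDiffOn.sum fun l _ => (g.contDiffOn_up μ l).mul (hS l ν)

/-- The covariant divergence commutes with raising the contracted index. -/
theorem divLower_eq_divMixed {S : Fin 4 → Fin 4 → Coord → ℝ}
    (hS : ∀ μ ν, ContDiffOn ℝ ∞ (S μ ν) Ω) (hx : x ∈ Ω) (ν : Fin 4) :
    g.divLower S ν x = g.divMixed (g.raiseFst S) ν x := by
  have hu (μ l : Fin 4) := differentiableAt_of_smooth (g.contDiffOn_up μ l) hx
  have hs (l : Fin 4) := differentiableAt_of_smooth (hS l ν) hx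
  have h1 (μ : Fin 4) : pd μ (g.raiseFst S μ ν) x =
      ∑ l, (- (∑ β, g.christoffel μ μ β x * g.up β l x
      + ∑ β, g.up μ β x * g.christoffel l μ β x) * S l ν x + g.up μ l x * pd μ (S l ν) x) := by
    unfold raiseFst
    rw [pd_sum fun l _ => (hu μ l).fun_mul (hs l)]
    exact Finset.sum_congr rfl fun l _ => by rw [pd_mul (hu μ l) (hs l), g.pd_up hx]
  simp only [divMixed, h1]
  simp only [divLower, covDerivLower, raiseFst]
  rw [Finset.sum_comm]
  refine Eq.trans (b := ∑ μ, ∑ l, g.up μ l x * (pd μ (S l ν) x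
    - ∑ β, g.christoffel β μ l x * S β ν x - ∑ β, g.christoffel β μ ν x * S l β x)) ?_ ?_
  · exact Finset.sum_congr rfl fun μ _ => Finset.sum_congr rfl fun l _ => by rw [g.up_symm hx l μ]
  refine Finset.sum_congr rfl fun μ _ => ?_
  -- The derivative of g^{μλ} brings two Christoffel terms. By `e3` one cancels the connection term
  -- of the raised index; by `e1` the other is the connection term of the lower index.
  have e1 : ∑ l, g.up μ l x * ∑ β, g.christoffel β μ l x * S β ν x =
      ∑ l, (∑ β, g.up μ β x * g.christoffel l μ β x) * S l ν x := by
    simp only [Finset.mul_sum, Finset.sum_mul, mul_assoc]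
    exact Finset.sum_comm
  have e2 : ∑ l, g.up μ l x * ∑ β, g.christoffel β μ ν x * S l β x =
      ∑ β, g.christoffel β μ ν x * ∑ l, g.up μ l x * S l β x := by
    simp only [Finset.mul_sum, mul_left_comm (g.up _ _ _)]
    exact Finset.sum_comm
  have e3 : ∑ β, g.christoffel μ μ β x * ∑ l, g.up β l x * S l ν x =
      ∑ l, (∑ β, g.christoffel μ μ β x * g.up β l x) * S l ν x := by
    simp only [Finset.mul_sum, Finset.sum_mul, mul_assoc]
    exact Finset.sum_comm
  simp only [mul_sub, Finset.sum_sub_distrib, neg_mul, add_mul, Finset.sum_add_distrib,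
    Finset.sum_neg_distrib]
  rw [e1, e2, e3]
  ring

/-- `∇_μ (g^{μα} g^{νβ} S_{αβ}) = g^{νβ} ∇^μ S_{μβ}`. -/
theorem divUpper_raise {S : Fin 4 → Fin 4 → Coord → ℝ}
    (hS : ∀ μ ν, ContDiffOn ℝ ∞ (S μ ν) Ω) (hx : x ∈ Ω) (ν : Fin 4) :
    g.divUpper (g.raise S) ν x = ∑ β, g.up ν β x * g.divLower S β x := by
  have hr := g.contDiffOn_raiseFst hS
  have hu (μ l : Fin 4) := differentiableAt_of_smooth (g.contDiffOn_up μ l) hx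
  have hs (μ l : Fin 4) := differentiableAt_of_smooth (hr μ l) hx
  have h0 (μ ν : Fin 4) (y : Coord) :
      g.raise S μ ν y = ∑ β, g.up ν β y * g.raiseFst S μ β y := by
    simp only [raise, raiseFst, Finset.mul_sum]
    rw [Finset.sum_comm]
    exact Finset.sum_congr rfl fun _ _ => Finset.sum_congr rfl fun _ _ => by ring
  have h1 (μ : Fin 4) : pd μ (g.raise S μ ν) x =
      ∑ l, (- (∑ β, g.christoffel ν μ β x * g.up β l x
      + ∑ β, g.up ν β x * g.christoffel l μ β x) * g.raiseFst S μ l x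
      + g.up ν l x * pd μ (g.raiseFst S μ l) x) := by
    rw [show g.raise S μ ν = _ from funext (h0 μ ν), pd_sum fun l _ => (hu ν l).fun_mul (hs μ l)]
    exact Finset.sum_congr rfl fun l _ => by rw [pd_mul (hu ν l) (hs μ l), g.pd_up hx]
  simp only [g.divLower_eq_divMixed hS hx, divUpper, covDerivUpper, h1]
  simp only [divMixed, h0]
  generalize g.raiseFst S = P
  simp only [Finset.mul_sum (Finset.univ) _ (g.up _ _ _)]
  rw [Finset.sum_comm (γ := Fin 4) (s := Finset.univ) (t := Finset.univ)
    (f := fun β μ => g.up ν β x * (pd μ (P μ β) x + ∑ a, g.christoffel μ μ a x * P a β x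
      - ∑ a, g.christoffel a μ β x * P μ a x))]
  refine Finset.sum_congr rfl fun μ _ => ?_
  have e1 : ∑ β, g.christoffel μ μ β x * ∑ l, g.up ν l x * P β l x =
      ∑ l, g.up ν l x * ∑ β, g.christoffel μ μ β x * P β l x := by
    simp only [Finset.mul_sum, mul_left_comm (g.up _ _ _)]
    exact Finset.sum_comm
  have e2 : ∑ β, g.christoffel ν μ β x * ∑ l, g.up β l x * P μ l x =
      ∑ l, (∑ β, g.christoffel ν μ β x * g.up β l x) * P μ l x := by
    simp only [Finset.mul_sum, Finset.sum_mul, mul_assoc]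
    exact Finset.sum_comm
  have e3 : ∑ l, (∑ β, g.up ν β x * g.christoffel l μ β x) * P μ l x =
      ∑ l, g.up ν l x * ∑ a, g.christoffel a μ l x * P μ a x := by
    simp only [Finset.mul_sum, Finset.sum_mul, mul_assoc]
    exact Finset.sum_comm
  simp only [mul_sub, mul_add, Finset.sum_sub_distrib, neg_mul, add_mul, Finset.sum_add_distrib,
    Finset.sum_neg_distrib] at e1 e2 e3 ⊢
  rw [e1, e2, e3]
  ring

/-- The mixed Ricci tensor `R^μ_ν`, as a contraction of `R^{γλ}_{μν}`. -/
noncomputable def ricciMixed (μ ν : Fin 4) (x : Coord) : ℝ := ∑ a, g.curvUp ν a x μ a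

theorem curvUp_antisymm_left (hx : x ∈ Ω) (μ ν a b : Fin 4) :
    g.curvUp μ ν x a b = - g.curvUp μ ν x b a :=
  congrFun (congrFun (g.curvUp_transpose hx μ ν) b) a

theorem curvUp_antisymm_right (μ ν a b : Fin 4) :
    g.curvUp μ ν x a b = - g.curvUp ν μ x a b := by
  rw [curvUp, g.curv_antisymm μ ν, neg_mul]
  rfl

/-- The antisymmetry in each index pair gives R^{μa}_{νa} = R^{aμ}_{aν}, and the latter is
g^{μλ}R^a_{λaν}. -/
theorem ricciMixed_eq (hx : x ∈ Ω) (μ ν : Fin 4) :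
    g.ricciMixed μ ν x = g.raiseFst g.ricci μ ν x := by
  have h1 : g.ricciMixed μ ν x = ∑ a, g.curvUp a ν x a μ :=
    Finset.sum_congr rfl fun a _ => by
      rw [g.curvUp_antisymm_left hx, g.curvUp_antisymm_right, neg_neg]
  simp only [h1, raiseFst, ricci, curvUp, Matrix.mul_apply, Finset.mul_sum]
  rw [Finset.sum_comm]
  refine Finset.sum_congr rfl fun l _ => Finset.sum_congr rfl fun a _ => ?_
  change g.riemann a l a ν x * g.up l μ x = _
  rw [g.up_symm hx l μ, mul_comm]

theorem scalarCurv_eq_sum_ricciMixed (hx : x ∈ Ω) : g.scalarCurv x = ∑ μ, g.ricciMixed μ μ x := by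
  simp only [g.ricciMixed_eq hx, raiseFst, scalarCurv]
  rw [Finset.sum_comm]
  exact Finset.sum_congr rfl fun μ _ => Finset.sum_congr rfl fun l _ => by rw [g.up_symm hx]

theorem contDiffOn_ricciMixed (μ ν : Fin 4) : ContDiffOn ℝ ∞ (g.ricciMixed μ ν) Ω :=
  ContDiffOn.sum fun a _ => g.smoothMat_curvUp ν a μ a

theorem contDiffOn_scalarCurv : ContDiffOn ℝ ∞ g.scalarCurv Ω :=
  (ContDiffOn.sum fun μ _ => g.contDiffOn_ricciMixed μ μ).congr
    fun _ hx => g.scalarCurv_eq_sum_ricciMixed hx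

theorem sum_antisymm_mul_symm {k c : Fin 4 → Fin 4 → ℝ} (hk : ∀ i j, k i j = - k j i)
    (hc : ∀ i j, c i j = c j i) : ∑ i, ∑ j, k i j * c i j = 0 := by
  have h : ∑ i, ∑ j, k i j * c i j = - ∑ i, ∑ j, k i j * c i j := by
    conv_lhs => rw [Finset.sum_comm]
    simp only [← Finset.sum_neg_distrib]
    exact Finset.sum_congr rfl fun i _ => Finset.sum_congr rfl fun j _ => by
      rw [hk j i, hc j i, neg_mul]
  linarith

/-- The contracted Bianchi identity `∂_α R = 2 ∇_μ R^μ_α`. -/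
theorem pd_scalarCurv (hx : x ∈ Ω) (α : Fin 4) :
    pd α g.scalarCurv x = 2 * g.divMixed g.ricciMixed α x := by
  have hd (b c i j : Fin 4) := (g.smoothMat_curvUp b c).differentiableAt hx i j
  have hP (a μ ν : Fin 4) : pd a (g.ricciMixed μ ν) x =
      ∑ b, pd a (fun y => g.curvUp ν b y μ b) x := by
    unfold ricciMixed
    exact pd_sum (fun b _ => hd ν b μ b) a
  have hR : pd α g.scalarCurv x = ∑ μ, ∑ ν, pd α (fun y => g.curvUp μ ν y μ ν) x := by
    rw [pd_congr (fun y hy => g.scalarCurv_eq_sum_ricciMixed hy) hx,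
      pd_sum fun μ _ => differentiableAt_of_smooth (g.contDiffOn_ricciMixed μ μ) hx]
    exact Finset.sum_congr rfl fun μ _ => hP α μ μ
  -- The double contraction: take the (μ, ν) entry of the Bianchi identity for R^{··}_{μν} and sum
  -- over μ and ν. The first cyclic term yields ∂_αR, the other two -∂_μR^μ_α each, up to connection
  -- terms.
  have hB : ∑ μ, ∑ ν, (pd α (fun y => g.curvUp μ ν y μ ν) x
      + ∑ β, g.christoffel μ α β x * g.curvUp μ ν x β ν
      + ∑ β, g.curvUp μ ν x μ β * g.christoffel ν α β x
      + (pd μ (fun y => g.curvUp ν α y μ ν) x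
      + ∑ β, g.christoffel μ μ β x * g.curvUp ν α x β ν
      + ∑ β, g.curvUp ν α x μ β * g.christoffel ν μ β x)
      + (pd ν (fun y => g.curvUp α μ y μ ν) x
      + ∑ β, g.christoffel μ ν β x * g.curvUp α μ x β ν
      + ∑ β, g.curvUp α μ x μ β * g.christoffel ν ν β x)) = 0 := by
    refine Finset.sum_eq_zero fun μ _ => Finset.sum_eq_zero fun ν _ => ?_
    have h := congrFun (congrFun (g.curvUp_bianchi hx α μ ν) μ) ν
    simp only [Matrix.add_apply, Matrix.mul_apply] at h
    exact h
  have kl (μ ν a b : Fin 4) := g.curvUp_antisymm_left hx μ ν a b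
  have kr (μ ν a b : Fin 4) := g.curvUp_antisymm_right (x := x) μ ν a b
  have dl (e μ ν a b : Fin 4) : pd e (fun y => g.curvUp μ ν y a b) x =
      - pd e (fun y => g.curvUp μ ν y b a) x := by
    rw [← pd_neg]
    exact pd_congr (fun y hy => g.curvUp_antisymm_left hy μ ν a b) hx e
  have dr (e μ ν a b : Fin 4) : pd e (fun y => g.curvUp μ ν y a b) x =
      - pd e (fun y => g.curvUp ν μ y a b) x := by
    rw [← pd_neg]
    exact pd_congr (fun y _ => g.curvUp_antisymm_right μ ν a b) hx e
  have cs (a b c : Fin 4) := g.christoffel_symm hx a b c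
  -- The connection terms: `x1` and `x2` both equal Γ^β_{μα}R^μ_β, while `z1` and `z2` both equal
  -- -Γ^μ_{μβ}R^β_α. Together they supply twice the connection part of ∇_μR^μ_α.
  have x1 : ∑ μ, ∑ ν, ∑ β, g.christoffel μ α β x * g.curvUp μ ν x β ν =
      ∑ μ, ∑ β, g.christoffel β μ α x * ∑ a, g.curvUp β a x μ a := by
    simp only [Finset.mul_sum]
    conv_rhs => rw [Finset.sum_comm]
    refine Finset.sum_congr rfl fun μ _ => ?_
    conv_rhs => rw [Finset.sum_comm]
    exact Finset.sum_congr rfl fun ν _ => Finset.sum_congr rfl fun β _ => by rw [cs]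
  have x2 : ∑ μ, ∑ ν, ∑ β, g.curvUp μ ν x μ β * g.christoffel ν α β x =
      ∑ μ, ∑ β, g.christoffel β μ α x * ∑ a, g.curvUp β a x μ a := by
    rw [← x1]
    conv_rhs => rw [Finset.sum_comm]
    exact Finset.sum_congr rfl fun ν _ => Finset.sum_congr rfl fun μ _ =>
      Finset.sum_congr rfl fun β _ => by rw [kl, kr, neg_neg, mul_comm]
  have y1 : ∑ μ, ∑ ν, pd μ (fun y => g.curvUp ν α y μ ν) x =
      - ∑ μ, ∑ a, pd μ (fun y => g.curvUp α a y μ a) x := by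
    simp only [← Finset.sum_neg_distrib]
    exact Finset.sum_congr rfl fun μ _ => Finset.sum_congr rfl fun ν _ => dr _ _ _ _ _
  have y2 : ∑ μ, ∑ ν, pd ν (fun y => g.curvUp α μ y μ ν) x =
      - ∑ μ, ∑ a, pd μ (fun y => g.curvUp α a y μ a) x := by
    rw [Finset.sum_comm]
    simp only [← Finset.sum_neg_distrib]
    exact Finset.sum_congr rfl fun μ _ => Finset.sum_congr rfl fun ν _ => dl _ _ _ _ _
  have z1 : ∑ μ, ∑ ν, ∑ β, g.christoffel μ μ β x * g.curvUp ν α x β ν =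
      - ∑ μ, ∑ β, g.christoffel μ μ β x * ∑ a, g.curvUp α a x β a := by
    simp only [← Finset.sum_neg_distrib, Finset.mul_sum]
    refine Finset.sum_congr rfl fun μ _ => ?_
    rw [Finset.sum_comm]
    exact Finset.sum_congr rfl fun β _ => Finset.sum_congr rfl fun ν _ => by
      rw [kr, mul_neg]
  have z2 : ∑ μ, ∑ ν, ∑ β, g.curvUp α μ x μ β * g.christoffel ν ν β x =
      - ∑ μ, ∑ β, g.christoffel μ μ β x * ∑ a, g.curvUp α a x β a := by
    simp only [← Finset.sum_neg_distrib, Finset.mul_sum]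
    rw [Finset.sum_comm]
    refine Finset.sum_congr rfl fun μ _ => ?_
    rw [Finset.sum_comm]
    exact Finset.sum_congr rfl fun β _ => Finset.sum_congr rfl fun ν _ => by
      rw [kl, neg_mul, mul_comm]
  -- `w1` and `w2` contract the curvature, antisymmetric in its upper pair, with the symmetric lower
  -- pair of Γ.
  have w1 : ∑ μ, ∑ ν, ∑ β, g.curvUp ν α x μ β * g.christoffel ν μ β x = 0 := by
    rw [Finset.sum_comm]
    exact Finset.sum_eq_zero fun ν _ =>
      sum_antisymm_mul_symm (fun i j => kl ν α i j) (fun i j => cs ν i j)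
  have w2 : ∑ μ, ∑ ν, ∑ β, g.christoffel μ ν β x * g.curvUp α μ x β ν = 0 := by
    refine Finset.sum_eq_zero fun μ _ => ?_
    rw [← sum_antisymm_mul_symm (fun i j => kl α μ j i) (fun i j => cs μ i j)]
    exact Finset.sum_congr rfl fun _ _ => Finset.sum_congr rfl fun _ _ => mul_comm _ _
  simp only [Finset.sum_add_distrib] at hB
  rw [← hR, x1, x2, y1, y2, z1, z2, w1, w2] at hB
  simp only [divMixed, hP, Finset.sum_add_distrib, Finset.sum_sub_distrib]
  simp only [ricciMixed]
  linarith

end LorentzMetric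

/-! ### Derivative of √(-g), forms of the d'Alembertian, and the Ricci identity. -/

variable {Ω : Opens Coord} {x : Coord}

theorem pd_prod {ι : Type*} [DecidableEq ι] {s : Finset ι} {F : ι → Coord → ℝ}
    (hF : ∀ i ∈ s, DifferentiableAt ℝ (F i) x) (μ : Fin 4) :
    pd μ (fun y => ∏ i ∈ s, F i y) x = ∑ i ∈ s, (∏ j ∈ s.erase i, F j x) * pd μ (F i) x := by
  simp [pd, fderiv_finsetProd hF]

/-- Jacobi's formula for the derivative of a determinant. -/
theorem pd_det {A : Coord → Matrix (Fin 4) (Fin 4) ℝ} (hA : SmoothMat Ω A) (hx : x ∈ Ω)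
    (μ : Fin 4) : pd μ (fun y => (A y).det) x = ((A x).adjugate * mpd μ A x).trace := by
  have hd := hA.differentiableAt hx
  have hp (s : Equiv.Perm (Fin 4)) : DifferentiableAt ℝ (fun y => ∏ i, A y (s i) i) x :=
    differentiableAt_of_smooth (contDiffOn_prod fun i _ => hA (s i) i) hx
  have h1 : pd μ (fun y => (A y).det) x =
      ∑ i, ((A x).updateCol i (fun j => mpd μ A x j i)).det := by
    simp only [Matrix.det_apply']
    rw [pd_sum fun s _ => (differentiableAt_const _).fun_mul (hp s), Finset.sum_comm]
    refine Finset.sum_congr rfl fun s _ => ?_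
    rw [pd_const_mul (hp s), pd_prod fun i _ => hd (s i) i, Finset.mul_sum]
    refine Finset.sum_congr rfl fun i _ => ?_
    rw [← Finset.mul_prod_erase _ _ (Finset.mem_univ i), mul_comm (∏ j ∈ _, _)]
    congr 2
    · simp [mpd]
    · refine Finset.prod_congr rfl fun j hj => ?_
      rw [Matrix.updateCol_ne (Finset.ne_of_mem_erase hj)]
  -- The determinant with column i replaced by its derivative is, by Cramer's rule, entry i of the
  -- adjugate applied to that column, a diagonal entry of adj(A)∂_μA.
  rw [h1]
  refine Finset.sum_congr rfl fun i _ => ?_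
  rw [← Matrix.cramer_apply, Matrix.cramer_eq_adjugate_mulVec]
  rfl

namespace LorentzMetric

variable (g : LorentzMetric Ω)

theorem sqrtNegDet_pos (hx : x ∈ Ω) : 0 < g.sqrtNegDet x :=
  Real.sqrt_pos.2 (by linarith [g.det_neg hx])

/-- Jacobi's formula with adj(g) = det(g) g⁻¹ and ∂_μg = gΓ_μ + Γ_μᵀg: each summand contributes tr
Γ_μ, hence the factor 2. -/
theorem pd_det_comp (hx : x ∈ Ω) (μ : Fin 4) :
    pd μ (fun y => (g.comp y).det) x = 2 * (g.comp x).det * (g.conn μ x).trace := by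
  have h1 : (g.comp x).adjugate = (g.comp x).det • g.inv x := by
    rw [inv, Matrix.inv_def, smul_smul, Ring.mul_inverse_cancel _ (g.isUnit_det hx), one_smul]
  rw [pd_det g.smoothMat_comp hx, h1, g.mpd_comp hx, Matrix.smul_mul, Matrix.trace_smul, mul_add,
    Matrix.trace_add, ← mul_assoc, g.inv_mul_comp hx, one_mul, Matrix.trace_mul_comm (g.inv x),
    mul_assoc, g.comp_mul_inv hx, mul_one, Matrix.trace_transpose, smul_eq_mul]
  ring

/-- Differentiate (√(-g))² = -g and cancel the positive factor √(-g). This is what identifies the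
density form of □ with a covariant divergence. -/
theorem pd_sqrtNegDet (hx : x ∈ Ω) (μ : Fin 4) :
    pd μ g.sqrtNegDet x = g.sqrtNegDet x * (g.conn μ x).trace := by
  have hs := differentiableAt_of_smooth g.contDiffOn_sqrtNegDet hx
  have hq : ∀ y ∈ Ω, g.sqrtNegDet y * g.sqrtNegDet y = - (g.comp y).det := fun y hy =>
    Real.mul_self_sqrt (by linarith [g.det_neg hy])
  have h1 := pd_congr hq hx μ
  rw [pd_mul hs hs, pd_neg, g.pd_det_comp hx] at h1
  have h2 := hq x hx
  have h3 := (g.sqrtNegDet_pos hx).ne'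
  refine mul_left_cancel₀ h3 ?_
  linear_combination h1 / 2 - (g.conn μ x).trace * h2

/-- The gradient `∇^μ F`. -/
noncomputable def grad (F : Coord → ℝ) (μ : Fin 4) (x : Coord) : ℝ := ∑ l, g.up μ l x * pd l F x

variable {F H φ : Coord → ℝ}

theorem contDiffOn_grad (hF : ContDiffOn ℝ ∞ F Ω) (μ : Fin 4) :
    ContDiffOn ℝ ∞ (g.grad F μ) Ω :=
  ContDiffOn.sum fun l _ => (g.contDiffOn_up μ l).mul (contDiffOn_pd l hF)

theorem contDiffOn_hess (hF : ContDiffOn ℝ ∞ F Ω) (μ ν : Fin 4) :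
    ContDiffOn ℝ ∞ (g.hess μ ν F) Ω :=
  (contDiffOn_pd μ (contDiffOn_pd ν hF)).sub
    (ContDiffOn.sum fun l _ => (g.contDiffOn_christoffel l μ ν).mul (contDiffOn_pd l hF))

theorem hess_symm (hF : ContDiffOn ℝ ∞ F Ω) (hx : x ∈ Ω) (μ ν : Fin 4) :
    g.hess μ ν F x = g.hess ν μ F x := by
  simp only [hess, pd_comm hF hx μ ν, g.christoffel_symm hx _ μ ν]

/-- `□F` is the covariant divergence of the gradient. -/
theorem box_eq_div_grad (hF : ContDiffOn ℝ ∞ F Ω) (hx : x ∈ Ω) :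
    g.box F x = ∑ μ, (pd μ (g.grad F μ) x + ∑ β, g.christoffel μ μ β x * g.grad F β x) := by
  have hs := differentiableAt_of_smooth g.contDiffOn_sqrtNegDet hx
  have hw (μ : Fin 4) := differentiableAt_of_smooth (g.contDiffOn_grad hF μ) hx
  have h1 (σ : Fin 4) : pd σ (fun y => g.sqrtNegDet y * ∑ l, g.up σ l y * pd l F y) x =
      g.sqrtNegDet x * (g.conn σ x).trace * g.grad F σ x
        + g.sqrtNegDet x * pd σ (g.grad F σ) x := by
    rw [← g.pd_sqrtNegDet hx]
    exact pd_mul hs (hw σ) σ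
  have h2 := (g.sqrtNegDet_pos hx).ne'
  simp only [box, h1, mul_assoc, ← mul_add, ← Finset.mul_sum]
  rw [inv_mul_cancel_left₀ h2, Finset.sum_add_distrib, Finset.sum_add_distrib, add_comm]
  congr 1
  rw [Finset.sum_comm]
  refine Finset.sum_congr rfl fun σ _ => ?_
  rw [← Finset.sum_mul]
  congr 1
  exact Finset.sum_congr rfl fun β _ => g.christoffel_symm hx β σ β

/-- The trace `g^{μα} S_{μα}`. -/
noncomputable def tr (S : Fin 4 → Fin 4 → Coord → ℝ) (x : Coord) : ℝ :=
  ∑ μ, ∑ α, g.up μ α x * S μ α x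

/-- Metric compatibility lets g^{μλ} leave the divergence of the gradient, so the density definition
of □ agrees with g^{μν}∇_μ∇_ν. -/
theorem box_eq_tr_hess (hF : ContDiffOn ℝ ∞ F Ω) (hx : x ∈ Ω) :
    g.box F x = g.tr (fun μ ν => g.hess μ ν F) x := by
  have hu (μ l : Fin 4) := differentiableAt_of_smooth (g.contDiffOn_up μ l) hx
  have hp (l : Fin 4) := differentiableAt_of_smooth (contDiffOn_pd l hF) hx
  have h1 (μ : Fin 4) : pd μ (g.grad F μ) x =
      ∑ l, (- (∑ β, g.christoffel μ μ β x * g.up β l x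
      + ∑ β, g.up μ β x * g.christoffel l μ β x) * pd l F x + g.up μ l x * pd μ (pd l F) x) := by
    unfold grad
    rw [pd_sum fun l _ => (hu μ l).fun_mul (hp l)]
    exact Finset.sum_congr rfl fun l _ => by rw [pd_mul (hu μ l) (hp l), g.pd_up hx]
  rw [g.box_eq_div_grad hF hx]
  simp only [tr, hess, h1, grad]
  refine Finset.sum_congr rfl fun μ _ => ?_
  have e1 : ∑ β, g.christoffel μ μ β x * ∑ l, g.up β l x * pd l F x =
      ∑ l, (∑ β, g.christoffel μ μ β x * g.up β l x) * pd l F x := by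
    simp only [Finset.mul_sum, Finset.sum_mul, mul_assoc]
    exact Finset.sum_comm
  have e2 : ∑ l, (∑ β, g.up μ β x * g.christoffel l μ β x) * pd l F x =
      ∑ β, g.up μ β x * ∑ l, g.christoffel l μ β x * pd l F x := by
    simp only [Finset.mul_sum, Finset.sum_mul, mul_assoc]
    exact Finset.sum_comm
  simp only [mul_sub, Finset.sum_sub_distrib, neg_mul, add_mul, Finset.sum_add_distrib,
    Finset.sum_neg_distrib]
  rw [e1, e2]
  ring

/-- The covariant derivative commutes with the trace. -/
theorem pd_tr {S : Fin 4 → Fin 4 → Coord → ℝ} (hS : ∀ μ ν, ContDiffOn ℝ ∞ (S μ ν) Ω)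
    (hx : x ∈ Ω) (ν : Fin 4) :
    pd ν (g.tr S) x = ∑ μ, ∑ α, g.up μ α x * g.covDerivLower S ν μ α x := by
  have hu (μ l : Fin 4) := differentiableAt_of_smooth (g.contDiffOn_up μ l) hx
  have hs (μ l : Fin 4) := differentiableAt_of_smooth (hS μ l) hx
  have h1 : pd ν (g.tr S) x = ∑ μ, ∑ α, (- (∑ β, g.christoffel μ ν β x * g.up β α x
      + ∑ β, g.up μ β x * g.christoffel α ν β x) * S μ α x + g.up μ α x * pd ν (S μ α) x) := by
    unfold tr
    rw [pd_sum fun μ _ => DifferentiableAt.fun_sum fun l _ => (hu μ l).fun_mul (hs μ l)]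
    refine Finset.sum_congr rfl fun μ _ => ?_
    rw [pd_sum fun l _ => (hu μ l).fun_mul (hs μ l)]
    exact Finset.sum_congr rfl fun l _ => by rw [pd_mul (hu μ l) (hs μ l), g.pd_up hx]
  rw [h1]
  have e1 : ∑ μ, ∑ α, (∑ β, g.christoffel μ ν β x * g.up β α x) * S μ α x =
      ∑ μ, ∑ α, g.up μ α x * ∑ β, g.christoffel β ν μ x * S β α x := by
    simp only [Finset.sum_mul, Finset.mul_sum]
    conv_rhs => rw [Finset.sum_comm]
    rw [Finset.sum_comm]
    refine Finset.sum_congr rfl fun α _ => ?_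
    rw [Finset.sum_comm]
    exact Finset.sum_congr rfl fun _ _ => Finset.sum_congr rfl fun _ _ => by ring
  have e2 : ∑ μ, ∑ α, (∑ β, g.up μ β x * g.christoffel α ν β x) * S μ α x =
      ∑ μ, ∑ α, g.up μ α x * ∑ β, g.christoffel β ν α x * S μ β x := by
    simp only [Finset.sum_mul, Finset.mul_sum, mul_assoc]
    exact Finset.sum_congr rfl fun _ _ => Finset.sum_comm
  simp only [covDerivLower, mul_sub, Finset.sum_sub_distrib, neg_mul, add_mul,
    Finset.sum_add_distrib, Finset.sum_neg_distrib]
  rw [e1, e2]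
  ring

/-- The Ricci identity for the covector field `∂F`. -/
theorem covDerivLower_hess (hF : ContDiffOn ℝ ∞ F Ω) (hx : x ∈ Ω) (α ν μ : Fin 4) :
    g.covDerivLower (fun μ ν => g.hess μ ν F) α ν μ x =
      g.covDerivLower (fun μ ν => g.hess μ ν F) ν α μ x
        - ∑ γ, pd γ F x * g.riemann γ μ α ν x := by
  have hc (a b c : Fin 4) := differentiableAt_of_smooth (g.contDiffOn_christoffel a b c) hx
  have hp (l : Fin 4) := differentiableAt_of_smooth (contDiffOn_pd l hF) hx
  have hpp (k l : Fin 4) := differentiableAt_of_smooth (contDiffOn_pd k (contDiffOn_pd l hF)) hx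
  have h1 (a b : Fin 4) : pd a (g.hess b μ F) x = pd a (pd b (pd μ F)) x -
      ∑ l, (pd a (g.christoffel l b μ) x * pd l F x
        + g.christoffel l b μ x * pd a (pd l F) x) := by
    unfold hess
    rw [pd_sub (hpp b μ) (DifferentiableAt.fun_sum fun l _ => (hc l b μ).fun_mul (hp l)),
      pd_sum fun l _ => (hc l b μ).fun_mul (hp l)]
    congr 1
    exact Finset.sum_congr rfl fun l _ => pd_mul (hc l b μ) (hp l) a
  have e (a b : Fin 4) : ∑ β, g.christoffel β a μ x * ∑ l, g.christoffel l b β x * pd l F x =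
      ∑ γ, pd γ F x * ∑ c, g.christoffel γ b c x * g.christoffel c a μ x := by
    simp only [Finset.mul_sum]
    rw [Finset.sum_comm]
    exact Finset.sum_congr rfl fun _ _ => Finset.sum_congr rfl fun _ _ => by ring
  simp only [covDerivLower, h1, pd_comm (contDiffOn_pd μ hF) hx ν α,
    g.christoffel_symm hx _ ν α, riemann]
  simp only [hess, mul_sub, mul_add, Finset.sum_sub_distrib, Finset.sum_add_distrib, e]
  simp only [mul_comm (pd _ F x) (pd _ _ x)]
  ring

/-- `∇^μ ∇_μ ∇_ν F = ∂_ν □F + R^γ_ν ∂_γ F`. -/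
theorem divLower_hess (hF : ContDiffOn ℝ ∞ F Ω) (hx : x ∈ Ω) (ν : Fin 4) :
    g.divLower (fun μ ν => g.hess μ ν F) ν x =
      pd ν (g.box F) x + ∑ γ, g.ricciMixed γ ν x * pd γ F x := by
  -- Symmetry of the Hessian puts the free index ν next to the derivative index α, where the Ricci
  -- identity can exchange the two; then g^{μα}∇_ν∇_α∇_μF is the derivative of a trace.
  have h1 (α μ : Fin 4) : g.covDerivLower (fun μ ν => g.hess μ ν F) α μ ν x =
      g.covDerivLower (fun μ ν => g.hess μ ν F) α ν μ x := by
    simp only [covDerivLower]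
    rw [pd_congr (fun y hy => g.hess_symm hF hy μ ν) hx]
    simp only [g.hess_symm hF hx _ ν, g.hess_symm hF hx μ]
    ring
  -- The curvature term of the Ricci identity contracts to Ricci with its lower pair reversed; this
  -- sign makes the Ricci term enter with a plus.
  have h2 (γ : Fin 4) : g.ricciMixed γ ν x =
      - ∑ μ, ∑ α, g.up μ α x * g.riemann γ μ α ν x := by
    simp only [ricciMixed, g.curvUp_antisymm_right ν, Finset.sum_neg_distrib]
    rw [Finset.sum_comm]
    congr 1
    refine Finset.sum_congr rfl fun α _ => ?_
    simp only [curvUp, Matrix.mul_apply]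
    exact Finset.sum_congr rfl fun μ _ => mul_comm _ _
  rw [pd_congr (fun y hy => g.box_eq_tr_hess hF hy) hx, g.pd_tr (g.contDiffOn_hess hF) hx]
  simp only [divLower, h1, g.covDerivLower_hess hF hx _ ν, h2, mul_sub, Finset.sum_sub_distrib,
    neg_mul, Finset.sum_neg_distrib]
  rw [sub_eq_add_neg]
  congr 1
  · refine Finset.sum_congr rfl fun μ _ => Finset.sum_congr rfl fun α _ => ?_
    congr 1
    simp only [covDerivLower]
    rw [pd_congr (fun y hy => g.hess_symm hF hy α μ) hx]
    simp only [g.hess_symm hF hx α, g.hess_symm hF hx _ μ]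
    ring
  · congr 1
    simp only [Finset.mul_sum, Finset.sum_mul]
    conv_rhs => rw [Finset.sum_comm]
    refine Finset.sum_congr rfl fun μ _ => ?_
    conv_rhs => rw [Finset.sum_comm]
    exact Finset.sum_congr rfl fun _ _ => Finset.sum_congr rfl fun _ _ => by ring

/-! ### Divergences of the terms of the field equations. -/

theorem divLower_add {S T : Fin 4 → Fin 4 → Coord → ℝ}
    (hS : ∀ μ ν, ContDiffOn ℝ ∞ (S μ ν) Ω) (hT : ∀ μ ν, ContDiffOn ℝ ∞ (T μ ν) Ω)
    (hx : x ∈ Ω) (ν : Fin 4) :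
    g.divLower (fun μ ν y => S μ ν y + T μ ν y) ν x = g.divLower S ν x + g.divLower T ν x := by
  simp only [divLower, covDerivLower, pd_add (differentiableAt_of_smooth (hS _ _) hx)
    (differentiableAt_of_smooth (hT _ _) hx), ← Finset.sum_add_distrib, mul_add]
  refine Finset.sum_congr rfl fun _ _ => Finset.sum_congr rfl fun _ _ => ?_
  simp only [Finset.sum_add_distrib]
  ring

/-- Leibniz rule for the divergence of `φ S_{μν}`. -/
theorem divLower_mul {S : Fin 4 → Fin 4 → Coord → ℝ}
    (hS : ∀ μ ν, ContDiffOn ℝ ∞ (S μ ν) Ω) (hφ : ContDiffOn ℝ ∞ φ Ω) (hx : x ∈ Ω) (ν : Fin 4) :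
    g.divLower (fun μ ν y => S μ ν y * φ y) ν x =
      g.divLower S ν x * φ x + ∑ μ, g.raiseFst S μ ν x * pd μ φ x := by
  simp only [divLower, covDerivLower, raiseFst, pd_mul (differentiableAt_of_smooth (hS _ _) hx)
    (differentiableAt_of_smooth hφ hx), Finset.sum_mul]
  have h : ∑ μ, ∑ l, g.up μ l x * S l ν x * pd μ φ x =
      ∑ μ, ∑ l, g.up μ l x * S μ ν x * pd l φ x := by
    rw [Finset.sum_comm]
    exact Finset.sum_congr rfl fun _ _ => Finset.sum_congr rfl fun _ _ => by
      rw [g.up_symm hx]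
  rw [h, ← Finset.sum_add_distrib]
  refine Finset.sum_congr rfl fun _ _ => ?_
  rw [← Finset.sum_add_distrib]
  refine Finset.sum_congr rfl fun _ _ => ?_
  simp only [← mul_assoc, ← Finset.sum_mul]
  ring

theorem divLower_const_mul {S : Fin 4 → Fin 4 → Coord → ℝ}
    (hS : ∀ μ ν, ContDiffOn ℝ ∞ (S μ ν) Ω) (c : ℝ) (hx : x ∈ Ω) (ν : Fin 4) :
    g.divLower (fun μ ν y => c * S μ ν y) ν x = c * g.divLower S ν x := by
  have h := g.divLower_mul hS (contDiffOn_const (c := c)) hx ν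
  simp only [pd_const, mul_zero, Finset.sum_const_zero, add_zero] at h
  simp only [mul_comm c]
  exact h

theorem raiseFst_lo (hx : x ∈ Ω) (μ ν : Fin 4) :
    g.raiseFst g.lo μ ν x = if μ = ν then 1 else 0 := by
  have := congrFun (congrFun (g.inv_mul_comp hx) μ) ν
  rw [Matrix.mul_apply, Matrix.one_apply] at this
  exact this

/-- Raising an index turns g into the constant Kronecker delta, for which the two connection terms
of the mixed divergence cancel. -/
theorem divLower_lo (hx : x ∈ Ω) (ν : Fin 4) : g.divLower g.lo ν x = 0 := by
  rw [g.divLower_eq_divMixed g.contDiffOn_lo hx,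
    g.divMixed_congr (T := fun μ ν _ => if μ = ν then 1 else 0)
      (fun y hy μ ν => g.raiseFst_lo hy μ ν) hx]
  simp only [divMixed, pd_const, mul_ite, mul_one, mul_zero, Finset.sum_ite_eq,
    Finset.sum_ite_eq', Finset.mem_univ, if_true, zero_add, g.christoffel_symm hx _ _ ν, sub_self,
    Finset.sum_const_zero]

theorem divLower_lo_mul (hφ : ContDiffOn ℝ ∞ φ Ω) (hx : x ∈ Ω) (ν : Fin 4) :
    g.divLower (fun μ ν y => g.lo μ ν y * φ y) ν x = pd ν φ x := by
  simp only [g.divLower_mul g.contDiffOn_lo hφ hx, g.divLower_lo hx, zero_mul, zero_add,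
    g.raiseFst_lo hx, ite_mul, one_mul, Finset.sum_ite_eq', Finset.mem_univ, if_true]

theorem contDiffOn_riemann (γ l μ ν : Fin 4) : ContDiffOn ℝ ∞ (g.riemann γ l μ ν) Ω :=
  g.smoothMat_curv μ ν γ l

theorem contDiffOn_ricci (μ ν : Fin 4) : ContDiffOn ℝ ∞ (g.ricci μ ν) Ω :=
  ContDiffOn.sum fun a _ => g.contDiffOn_riemann a μ a ν

theorem contDiffOn_einstein (μ ν : Fin 4) : ContDiffOn ℝ ∞ (g.einstein μ ν) Ω :=
  (g.contDiffOn_ricci μ ν).sub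
    ((contDiffOn_const.mul (g.contDiffOn_lo μ ν)).mul g.contDiffOn_scalarCurv)

theorem divLower_ricci (hx : x ∈ Ω) (ν : Fin 4) :
    g.divLower g.ricci ν x = (1 / 2) * pd ν g.scalarCurv x := by
  rw [g.divLower_eq_divMixed g.contDiffOn_ricci hx,
    ← g.divMixed_congr (fun y hy μ ν => g.ricciMixed_eq hy μ ν) hx, g.pd_scalarCurv hx]
  ring

/-- The contracted Bianchi identity `∇^μ G_{μν} = 0`. -/
theorem divLower_einstein (hx : x ∈ Ω) (ν : Fin 4) : g.divLower g.einstein ν x = 0 := by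
  have hR := g.contDiffOn_scalarCurv
  rw [g.divLower_congr (T := fun μ ν y => g.ricci μ ν y
      + -(1 / 2) * (g.lo μ ν y * g.scalarCurv y)) (fun y _ μ ν => by simp only [einstein]; ring) hx,
    g.divLower_add g.contDiffOn_ricci
      (fun μ ν => contDiffOn_const.mul ((g.contDiffOn_lo μ ν).mul hR)) hx,
    g.divLower_const_mul (fun μ ν => (g.contDiffOn_lo μ ν).mul hR) _ hx,
    g.divLower_lo_mul hR hx, g.divLower_ricci hx]
  ring

theorem raiseFst_einstein (hx : x ∈ Ω) (μ ν : Fin 4) :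
    g.raiseFst g.einstein μ ν x =
      g.ricciMixed μ ν x - (1 / 2) * (if μ = ν then 1 else 0) * g.scalarCurv x := by
  rw [g.ricciMixed_eq hx, ← g.raiseFst_lo hx]
  simp only [raiseFst, einstein, mul_sub, Finset.sum_sub_distrib, Finset.mul_sum, Finset.sum_mul]
  congr 1
  exact Finset.sum_congr rfl fun _ _ => by ring

/-- `∇^μ (G_{μν} + g_{μν} □ - ∇_μ ∇_ν) F = - ½ R ∂_ν F`. -/
theorem divLower_einstein_operator (hF : ContDiffOn ℝ ∞ F Ω) (hx : x ∈ Ω) (ν : Fin 4) :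
    g.divLower (fun μ ν y => g.einstein μ ν y * F y + g.lo μ ν y * g.box F y
      + -1 * g.hess μ ν F y) ν x = - (1 / 2) * g.scalarCurv x * pd ν F x := by
  have hB := g.contDiffOn_box hF
  have hE := g.contDiffOn_einstein
  have hH := g.contDiffOn_hess hF
  have hL := g.contDiffOn_lo
  rw [g.divLower_add (fun μ ν => ((hE μ ν).mul hF).add ((hL μ ν).mul hB))
      (fun μ ν => contDiffOn_const.mul (hH μ ν)) hx,
    g.divLower_add (fun μ ν => (hE μ ν).mul hF) (fun μ ν => (hL μ ν).mul hB) hx,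
    g.divLower_const_mul hH _ hx, g.divLower_hess hF hx, g.divLower_lo_mul hB hx,
    g.divLower_mul hE hF hx, g.divLower_einstein hx]
  -- The terms ±∂_ν□F cancel, and R^μ_ν∂_μF from the Einstein tensor cancels the commutator term of
  -- `divLower_hess`; the trace part -½R∂_νF is left.
  simp only [g.raiseFst_einstein hx, sub_mul, Finset.sum_sub_distrib, mul_ite, ite_mul, mul_one,
    mul_zero, zero_mul, Finset.sum_ite_eq', Finset.mem_univ, if_true]
  ring

theorem divLower_pd_mul_pd (hF : ContDiffOn ℝ ∞ F Ω) (hH : ContDiffOn ℝ ∞ H Ω) (hx : x ∈ Ω)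
    (ν : Fin 4) : g.divLower (fun μ ν y => pd μ F y * pd ν H y) ν x =
      g.box F x * pd ν H x + ∑ μ, g.grad F μ x * g.hess μ ν H x := by
  have hs (μ ν : Fin 4) := (contDiffOn_pd μ hF).mul (contDiffOn_pd ν hH)
  have hw (μ : Fin 4) := differentiableAt_of_smooth (g.contDiffOn_grad hF μ) hx
  have hp (l : Fin 4) := differentiableAt_of_smooth (contDiffOn_pd l hH) hx
  rw [g.divLower_eq_divMixed hs hx, g.divMixed_congr
    (T := fun μ ν y => g.grad F μ y * pd ν H y) (fun y _ μ ν => by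
      simp only [raiseFst, grad, Finset.sum_mul, mul_assoc]) hx, g.box_eq_div_grad hF hx]
  simp only [divMixed, hess, pd_mul (hw _) (hp _), Finset.sum_mul, add_mul, mul_sub,
    Finset.mul_sum, ← Finset.sum_add_distrib]
  refine Finset.sum_congr rfl fun μ _ => ?_
  simp only [mul_assoc, mul_left_comm (g.grad _ _ _)]
  ring

/-- `∂_ν (g^{σλ} ∂_σF ∂_λH) = ∇^μF ∇_μ∇_νH + ∇^μH ∇_μ∇_νF`. -/
theorem pd_tr_pd_mul_pd (hF : ContDiffOn ℝ ∞ F Ω) (hH : ContDiffOn ℝ ∞ H Ω) (hx : x ∈ Ω)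
    (ν : Fin 4) : pd ν (g.tr fun σ l y => pd σ F y * pd l H y) x =
      ∑ μ, g.grad F μ x * g.hess μ ν H x + ∑ μ, g.grad H μ x * g.hess μ ν F x := by
  have hp (l : Fin 4) := differentiableAt_of_smooth (contDiffOn_pd l hF) hx
  have hq (l : Fin 4) := differentiableAt_of_smooth (contDiffOn_pd l hH) hx
  have h1 (μ α : Fin 4) : g.covDerivLower (fun σ l y => pd σ F y * pd l H y) ν μ α x =
      g.hess μ ν F x * pd α H x + pd μ F x * g.hess α ν H x := by
    rw [g.hess_symm hF hx μ, g.hess_symm hH hx α]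
    simp only [covDerivLower, hess, pd_mul (hp _) (hq _), sub_mul, mul_sub, Finset.sum_mul,
      Finset.mul_sum, mul_assoc, mul_left_comm (pd μ F x)]
    ring
  rw [g.pd_tr (fun σ l => (contDiffOn_pd σ hF).mul (contDiffOn_pd l hH)) hx]
  simp only [h1, mul_add, Finset.sum_add_distrib, grad, Finset.sum_mul]
  rw [add_comm]
  congr 1
  · rw [Finset.sum_comm]
    exact Finset.sum_congr rfl fun _ _ => Finset.sum_congr rfl fun _ _ => by
      rw [g.up_symm hx]; ring
  · exact Finset.sum_congr rfl fun _ _ => Finset.sum_congr rfl fun _ _ => by ring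

/-- Divergence of `(δ_μ^{(σ} δ_ν^{λ)} - ½ g_{μν} g^{σλ}) ∂_σF ∂_λH`. -/
theorem divLower_stress (hF : ContDiffOn ℝ ∞ F Ω) (hH : ContDiffOn ℝ ∞ H Ω) (hx : x ∈ Ω)
    (ν : Fin 4) :
    g.divLower (fun μ ν y => (1 / 2) * (pd μ F y * pd ν H y + pd μ H y * pd ν F y
      + -1 * (g.lo μ ν y * g.tr (fun σ l y => pd σ F y * pd l H y) y))) ν x =
      (1 / 2) * (g.box F x * pd ν H x + g.box H x * pd ν F x) := by
  have hp (l : Fin 4) := contDiffOn_pd l hF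
  have hq (l : Fin 4) := contDiffOn_pd l hH
  have hL := g.contDiffOn_lo
  have ht : ContDiffOn ℝ ∞ (g.tr fun σ l y => pd σ F y * pd l H y) Ω :=
    ContDiffOn.sum fun σ _ => ContDiffOn.sum fun l _ =>
      (g.contDiffOn_up σ l).mul ((hp σ).mul (hq l))
  have h1 (μ ν : Fin 4) := ((hp μ).mul (hq ν)).add ((hq μ).mul (hp ν))
  have h2 (μ ν : Fin 4) := (contDiffOn_const (c := (-1 : ℝ))).mul ((hL μ ν).mul ht)
  rw [g.divLower_const_mul (fun μ ν => (h1 μ ν).add (h2 μ ν)) _ hx, g.divLower_add h1 h2 hx,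
    g.divLower_add (fun μ ν => (hp μ).mul (hq ν)) (fun μ ν => (hq μ).mul (hp ν)) hx,
    g.divLower_const_mul (fun μ ν => (hL μ ν).mul ht) _ hx, g.divLower_lo_mul ht hx,
    g.divLower_pd_mul_pd hF hH hx, g.divLower_pd_mul_pd hH hF hx, g.pd_tr_pd_mul_pd hF hH hx]
  -- The products of a gradient with a Hessian from the two symmetrized terms are exactly the
  -- derivative of the trace, so only the □ terms remain.
  ring

end LorentzMetric

/-! ### Integration by parts and the inversion of □⁻¹. -/

variable {Ω : Opens Coord} {x : Coord}

theorem tsupport_pd_subset (σ : Fin 4) (W : Coord → ℝ) : tsupport (pd σ W) ⊆ tsupport W := by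
  refine closure_minimal (fun x hx => ?_) (isClosed_tsupport _)
  by_contra hc
  exact hx (LorentzMetric.pd_eq_zero (notMem_tsupport_iff_eventuallyEq.1 hc))

theorem integrable_mul_of_tsupport_subset {A W : Coord → ℝ} (hA : ContinuousOn A Ω)
    (hW : ContinuousOn W Ω) (hc : HasCompactSupport W) (hs : tsupport W ⊆ Ω) :
    Integrable (fun x => A x * W x) := by
  refine Continuous.integrable_of_hasCompactSupport ?_ hc.mul_left
  exact (hA.mul hW).continuous_of_tsupport_subset Ω.isOpen ((tsupport_mul_subset_right).trans hs)

theorem setIntegral_eq_integral_of_tsupport_subset {A W : Coord → ℝ} (hs : tsupport W ⊆ Ω) :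
    ∫ x in Ω, A x * W x = ∫ x, A x * W x :=
  setIntegral_eq_integral_of_forall_compl_eq_zero fun x hx => by
    rw [image_eq_zero_of_notMem_tsupport fun h => hx (hs h), mul_zero]

/-- Integration by parts on `Ω` against a function with compact support in `Ω`. -/
theorem setIntegral_mul_pd {A W : Coord → ℝ} (hA : ContDiffOn ℝ ∞ A Ω)
    (hW : ContDiffOn ℝ ∞ W Ω) (hc : HasCompactSupport W) (hs : tsupport W ⊆ Ω) (σ : Fin 4) :
    ∫ x in Ω, A x * pd σ W x = - ∫ x in Ω, pd σ A x * W x := by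
  have hs' := (tsupport_pd_subset σ W).trans hs
  have hc' : HasCompactSupport (pd σ W) :=
    hc.of_isClosed_subset (isClosed_tsupport _) (tsupport_pd_subset σ W)
  -- Both integrands vanish off the support of W, so the integrals extend to ℝ⁴ and no boundary term
  -- arises, whatever A is outside Ω.
  rw [setIntegral_eq_integral_of_tsupport_subset hs,
    setIntegral_eq_integral_of_tsupport_subset hs']
  refine integral_mul_fderiv_eq_neg_fderiv_mul_of_integrable
    (integrable_mul_of_tsupport_subset (LorentzMetric.contDiffOn_pd σ hA).continuousOn
      hW.continuousOn hc hs)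
    (integrable_mul_of_tsupport_subset hA.continuousOn
      (LorentzMetric.contDiffOn_pd σ hW).continuousOn hc' hs')
    (integrable_mul_of_tsupport_subset hA.continuousOn hW.continuousOn hc hs)
    (fun x hx => differentiableAt_of_smooth hA (hs hx)) (fun x _ => ?_)
  by_cases hx : x ∈ Ω
  · exact differentiableAt_of_smooth hW hx
  · exact (differentiableAt_const (0 : ℝ)).congr_of_eventuallyEq
      (notMem_tsupport_iff_eventuallyEq.1 fun h => hx (hs h))

namespace LorentzMetric

variable (g : LorentzMetric Ω)

theorem sqrtNegDet_mul_box (hx : x ∈ Ω) (F : Coord → ℝ) : g.sqrtNegDet x * g.box F x =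
    ∑ σ, pd σ (fun y => g.sqrtNegDet y * g.grad F σ y) x :=
  mul_inv_cancel_left₀ (g.sqrtNegDet_pos hx).ne' _

/-- The operator `√(-g) □` is formally self-adjoint. -/
theorem setIntegral_mul_boxTest {u : Coord → ℝ} (hu : ContDiffOn ℝ ∞ u Ω) (h : 𝓓(Ω, ℝ)) :
    ∫ x in Ω, u x * g.boxTest h x = ∫ x in Ω, g.sqrtNegDet x * g.box u x * h x := by
  have hh : ContDiffOn ℝ ∞ h Ω := h.contDiff.contDiffOn
  have hflux {F : Coord → ℝ} (hF : ContDiffOn ℝ ∞ F Ω) (σ : Fin 4) :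
      ContDiffOn ℝ ∞ (fun y => g.sqrtNegDet y * g.grad F σ y) Ω :=
    g.contDiffOn_sqrtNegDet.mul (g.contDiffOn_grad hF σ)
  have hs (σ : Fin 4) : tsupport (fun y => g.sqrtNegDet y * g.grad h σ y) ⊆ tsupport h := by
    refine closure_minimal (fun x hx => ?_) (isClosed_tsupport _)
    by_contra hc
    refine hx ?_
    have h0 (l : Fin 4) : pd l h x = 0 := pd_eq_zero (notMem_tsupport_iff_eventuallyEq.1 hc)
    simp [grad, h0]
  have hc (σ : Fin 4) : HasCompactSupport (fun y => g.sqrtNegDet y * g.grad h σ y) :=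
    h.hasCompactSupport.of_isClosed_subset (isClosed_tsupport _) (hs σ)
  have hsΩ (σ : Fin 4) := (hs σ).trans h.tsupport_subset
  have hpc (σ : Fin 4) {W : Coord → ℝ} (hW : HasCompactSupport W) : HasCompactSupport (pd σ W) :=
    hW.of_isClosed_subset (isClosed_tsupport _) (tsupport_pd_subset σ W)
  -- Each side is reduced by one integration by parts to -∫ √(-g) g^{σλ} ∂_σu ∂_λh, and `hpt`
  -- matches the two forms by the symmetry of g^{σλ}.
  have hl : ∫ x in Ω, u x * g.boxTest h x =
      - ∑ σ, ∫ x in Ω, pd σ u x * (g.sqrtNegDet x * g.grad h σ x) := by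
    rw [setIntegral_congr_fun (g := fun x => ∑ σ, u x *
      pd σ (fun y => g.sqrtNegDet y * g.grad h σ y) x) Ω.isOpen.measurableSet fun x hx => by
        change u x * (g.sqrtNegDet x * g.box h x) = _
        rw [g.sqrtNegDet_mul_box hx, Finset.mul_sum]]
    rw [integral_finsetSum, ← Finset.sum_neg_distrib]
    · exact Finset.sum_congr rfl fun σ _ => setIntegral_mul_pd hu (hflux hh σ) (hc σ) (hsΩ σ) σ
    · exact fun σ _ => (integrable_mul_of_tsupport_subset hu.continuousOn
        (contDiffOn_pd σ (hflux hh σ)).continuousOn (hpc σ (hc σ))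
        ((tsupport_pd_subset σ _).trans (hsΩ σ))).integrableOn
  have hr : ∫ x in Ω, g.sqrtNegDet x * g.box u x * h x =
      - ∑ σ, ∫ x in Ω, (g.sqrtNegDet x * g.grad u σ x) * pd σ h x := by
    rw [setIntegral_congr_fun (g := fun x => ∑ σ,
      pd σ (fun y => g.sqrtNegDet y * g.grad u σ y) x * h x) Ω.isOpen.measurableSet
      fun x hx => by
        rw [g.sqrtNegDet_mul_box hx, Finset.sum_mul]]
    rw [integral_finsetSum, ← Finset.sum_neg_distrib]
    · refine Finset.sum_congr rfl fun σ _ => ?_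
      rw [setIntegral_mul_pd (hflux hu σ) hh h.hasCompactSupport h.tsupport_subset σ, neg_neg]
    · exact fun σ _ => (integrable_mul_of_tsupport_subset
        (contDiffOn_pd σ (hflux hu σ)).continuousOn hh.continuousOn h.hasCompactSupport
        h.tsupport_subset).integrableOn
  have hpt (x : Coord) (hx : x ∈ Ω) : ∑ σ, pd σ u x * (g.sqrtNegDet x * g.grad h σ x) =
      ∑ σ, (g.sqrtNegDet x * g.grad u σ x) * pd σ h x := by
    simp only [grad, Finset.mul_sum, Finset.sum_mul]
    rw [Finset.sum_comm]
    exact Finset.sum_congr rfl fun σ _ => Finset.sum_congr rfl fun l _ => by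
      rw [g.up_symm hx l σ]; ring
  rw [hl, hr, ← integral_finsetSum, ← integral_finsetSum,
    setIntegral_congr_fun Ω.isOpen.measurableSet hpt]
  · exact fun σ _ => (integrable_mul_of_tsupport_subset (hflux hu σ).continuousOn
      (contDiffOn_pd σ hh).continuousOn (hpc σ h.hasCompactSupport)
      ((tsupport_pd_subset σ _).trans h.tsupport_subset)).integrableOn
  · exact fun σ _ => (integrable_mul_of_tsupport_subset (contDiffOn_pd σ hu).continuousOn
      (hflux hh σ).continuousOn (hc σ) (hsΩ σ)).integrableOn

/-- If `u = □⁻¹ p` with `p` continuous, then `□u = p`. -/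
theorem IsBoxInv.box_eq {G : Coord → 𝓓'(Ω, ℝ)} {p u : Coord → ℝ} (hu : g.IsBoxInv G p u)
    (hG : g.IsRetardedGreen G) (hp : ContinuousOn p Ω) (hx : x ∈ Ω) : g.box u x = p x := by
  have hs := g.contDiffOn_sqrtNegDet.continuousOn
  have hb := (g.contDiffOn_box hu.smooth).continuousOn
  -- Fundamental lemma of the calculus of variations: √(-g)(□u - p) integrates to zero against every
  -- test function.
  have hae : ∀ᵐ x, x ∈ (Ω : Set Coord) →
      g.sqrtNegDet x * g.box u x - g.sqrtNegDet x * p x = 0 := by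
    refine Ω.isOpen.ae_eq_zero_of_integral_contDiff_smul_eq_zero
      (((hs.mul hb).sub (hs.mul hp)).locallyIntegrableOn Ω.isOpen.measurableSet) ?_
    intro φ hφ hφc hφs
    let h : 𝓓(Ω, ℝ) := ⟨φ, hφ, hφc, hφs⟩
    have h1 : ∫ x in Ω, g.sqrtNegDet x * g.box u x * φ x =
        ∫ x in Ω, g.sqrtNegDet x * p x * φ x := by
      refine (g.setIntegral_mul_boxTest hu.smooth h).symm.trans ?_
      -- Using √(-g)□h as the test function in the definition of □⁻¹, the Green equation collapses
      -- the pairing with G(·, y) to the value at y of √(-g)□h's source function h.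
      rw [hu.eq_integral]
      refine setIntegral_congr_fun Ω.isOpen.measurableSet fun y hy => ?_
      rw [hG.green y hy]
      change g.sqrtNegDet y * φ y * p y = _
      ring
    rw [setIntegral_eq_integral_of_tsupport_subset hφs,
      setIntegral_eq_integral_of_tsupport_subset hφs, ← sub_eq_zero, ← integral_sub
        (integrable_mul_of_tsupport_subset (A := fun y => g.sqrtNegDet y * g.box u y) (hs.mul hb)
          hφ.continuous.continuousOn hφc hφs)
        (integrable_mul_of_tsupport_subset (A := fun y => g.sqrtNegDet y * p y) (hs.mul hp)
          hφ.continuous.continuousOn hφc hφs)] at h1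
    rw [← h1]
    exact integral_congr_ae (.of_forall fun y => by simp only [smul_eq_mul]; ring)
  -- Both sides are continuous on the open set Ω, so almost everywhere equality holds at every
  -- point.
  have heq := Measure.eqOn_open_of_ae_eq (μ := volume)
    (f := fun x => g.sqrtNegDet x * g.box u x) (g := fun x => g.sqrtNegDet x * p x)
    ((ae_restrict_iff' Ω.isOpen.measurableSet).2
      (hae.mono fun y hy hyΩ => sub_eq_zero.1 (hy hyΩ))) Ω.isOpen (hs.mul hb) (hs.mul hp) hx
  exact mul_left_cancel₀ (g.sqrtNegDet_pos hx).ne' heq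

/-- Contracting the Kronecker deltas splits ΔG into the operator part and the two-scalar stress
part. Differences are written with the factor -1 to suit `divLower_add` and `divLower_const_mul`. -/
theorem deltaG_eq (f : ℝ → ℝ) (U V : Coord → ℝ) (μ ν : Fin 4) (x : Coord) :
    g.deltaG f U V μ ν x =
      (g.einstein μ ν x * (f (U x) + V x) + g.lo μ ν x * g.box (fun y => f (U y) + V y) x
        + -1 * g.hess μ ν (fun y => f (U y) + V y) x)
      + (1 / 2) * (pd μ V x * pd ν U x + pd μ U x * pd ν V x
        + -1 * (g.lo μ ν x * g.tr (fun σ l y => pd σ V y * pd l U y) x)) := by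
  have h1 : ∑ σ, ∑ l,
        ((1 / 2) * ((if σ = μ then 1 else 0) * (if l = ν then 1 else 0)
            + (if l = μ then 1 else 0) * (if σ = ν then 1 else 0))
          - (1 / 2) * g.lo μ ν x * g.up σ l x) * pd σ V x * pd l U x =
      (1 / 2) * (pd μ V x * pd ν U x + pd μ U x * pd ν V x
        + -1 * (g.lo μ ν x * g.tr (fun σ l y => pd σ V y * pd l U y) x)) := by
    have e (σ l : Fin 4) : ((1 / 2) * ((if σ = μ then (1 : ℝ) else 0) * (if l = ν then 1 else 0)
            + (if l = μ then 1 else 0) * (if σ = ν then 1 else 0))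
          - (1 / 2) * g.lo μ ν x * g.up σ l x) * pd σ V x * pd l U x =
        (if l = ν then (if σ = μ then (1 / 2) * (pd σ V x * pd l U x) else 0) else 0)
        + (if l = μ then (if σ = ν then (1 / 2) * (pd σ V x * pd l U x) else 0) else 0)
        - (1 / 2) * g.lo μ ν x * (g.up σ l x * (pd σ V x * pd l U x)) := by
      split_ifs <;> ring
    simp only [e, Finset.sum_sub_distrib, Finset.sum_add_distrib, Finset.sum_ite_eq',
      Finset.mem_univ, if_true, ← Finset.mul_sum, tr]
    ring
  rw [deltaG, h1]
  ring

end LorentzMetric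

end NonlocalGravity

/-! ### Cancellation of the divergence and conservation of T. -/

theorem mainTheorem1
    (Ω : Opens NonlocalGravity.Coord) (g : NonlocalGravity.LorentzMetric Ω)
    (G : NonlocalGravity.Coord → 𝓓'(Ω, ℝ)) (hG : g.IsRetardedGreen G)
    (f : ℝ → ℝ) (U V : NonlocalGravity.Coord → ℝ)
    (hU : g.IsBoxInv G g.scalarCurv U)
    (hf : AnalyticOnNhd ℝ f (U '' Ω))
    (hV : g.IsBoxInv G (fun x => g.scalarCurv x * deriv f (U x)) V) :
    (∀ x ∈ Ω, ∀ ν : Fin 4,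
      g.divLower (fun μ ν y => g.einstein μ ν y + g.deltaG f U V μ ν y) ν x = 0) ∧
    (∀ (χ : ℝ) (T : Fin 4 → Fin 4 → NonlocalGravity.Coord → ℝ), χ ≠ 0 →
      (∀ x ∈ Ω, ∀ μ ν : Fin 4,
        g.einstein μ ν x + g.deltaG f U V μ ν x = χ * T μ ν x) →
      ∀ x ∈ Ω, ∀ ν : Fin 4, g.divUpper (g.raise T) ν x = 0) := by
  have hsU := hU.smooth
  have hsV := hV.smooth
  have hE := g.contDiffOn_einstein
  have hfa {x : NonlocalGravity.Coord} (hx : x ∈ Ω) : AnalyticAt ℝ f (U x) := hf _ ⟨x, hx, rfl⟩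
  have hfU : ContDiffOn ℝ ∞ (fun y => f (U y)) Ω := fun x hx =>
    ((hfa hx).contDiffAt.comp_contDiffWithinAt x (hsU x hx))
  have hdf : ContinuousOn (fun x => g.scalarCurv x * deriv f (U x)) Ω :=
    g.contDiffOn_scalarCurv.continuousOn.mul fun x hx =>
      (hfa hx).deriv.continuousAt.comp_continuousWithinAt (hsU.continuousOn x hx)
  have hF : ContDiffOn ℝ ∞ (fun y => f (U y) + V y) Ω := hfU.add hsV
  have hA (μ ν : Fin 4) : ContDiffOn ℝ ∞ (fun y => g.einstein μ ν y * (f (U y) + V y)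
      + g.lo μ ν y * g.box (fun y => f (U y) + V y) y
      + -1 * g.hess μ ν (fun y => f (U y) + V y) y) Ω :=
    (((hE μ ν).mul hF).add ((g.contDiffOn_lo μ ν).mul (g.contDiffOn_box hF))).add
      (contDiffOn_const.mul (g.contDiffOn_hess hF μ ν))
  have hp (l : Fin 4) := NonlocalGravity.LorentzMetric.contDiffOn_pd l hsV
  have hq (l : Fin 4) := NonlocalGravity.LorentzMetric.contDiffOn_pd l hsU
  have hQ (μ ν : Fin 4) : ContDiffOn ℝ ∞ (fun y => (1 / 2) * (NonlocalGravity.pd μ V y * NonlocalGravity.pd ν U y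
      + NonlocalGravity.pd μ U y * NonlocalGravity.pd ν V y
      + -1 * (g.lo μ ν y * g.tr (fun σ l y => NonlocalGravity.pd σ V y * NonlocalGravity.pd l U y) y))) Ω :=
    contDiffOn_const.mul ((((hp μ).mul (hq ν)).add ((hq μ).mul (hp ν))).add
      (contDiffOn_const.mul ((g.contDiffOn_lo μ ν).mul (ContDiffOn.sum fun σ _ =>
        ContDiffOn.sum fun l _ => (g.contDiffOn_up σ l).mul ((hp σ).mul (hq l))))))
  have hD (μ ν : Fin 4) : ContDiffOn ℝ ∞ (g.deltaG f U V μ ν) Ω :=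
    ((hA μ ν).add (hQ μ ν)).congr fun y _ => g.deltaG_eq f U V μ ν y
  have hdiv : ∀ x ∈ Ω, ∀ ν : Fin 4,
      g.divLower (fun μ ν y => g.einstein μ ν y + g.deltaG f U V μ ν y) ν x = 0 := by
    intro x hx ν
    rw [g.divLower_add hE hD hx, g.divLower_einstein hx,
      g.divLower_congr (fun y _ μ ν => g.deltaG_eq f U V μ ν y) hx, g.divLower_add hA hQ hx,
      g.divLower_einstein_operator hF hx, g.divLower_stress hsV hsU hx,
      hV.box_eq g hG hdf hx, hU.box_eq g hG g.contDiffOn_scalarCurv.continuousOn hx,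
      NonlocalGravity.pd_add (NonlocalGravity.differentiableAt_of_smooth hfU hx) (NonlocalGravity.differentiableAt_of_smooth hsV hx),
      NonlocalGravity.pd_comp (hfa hx).differentiableAt (NonlocalGravity.differentiableAt_of_smooth hsU hx)]
    -- What is left is -½R(f'∂_νU + ∂_νV) + ½(Rf'∂_νU + R∂_νV) = 0.
    ring
  refine ⟨hdiv, fun χ T hχ hT x hx ν => ?_⟩
  have hTE : ∀ y ∈ Ω, ∀ μ ν, T μ ν y = χ⁻¹ * (g.einstein μ ν y + g.deltaG f U V μ ν y) :=
    fun y hy μ ν => by rw [hT y hy, inv_mul_cancel_left₀ hχ]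
  -- No regularity of T is assumed; the field equations with χ ≠ 0 transfer it from G + ΔG.
  have hTs (μ ν : Fin 4) : ContDiffOn ℝ ∞ (T μ ν) Ω :=
    (contDiffOn_const.mul ((hE μ ν).add (hD μ ν))).congr fun y hy => hTE y hy μ ν
  rw [g.divUpper_raise hTs hx]
  refine Finset.sum_eq_zero fun β _ => ?_
  rw [g.divLower_congr hTE hx, g.divLower_const_mul (fun μ ν => (hE μ ν).add (hD μ ν)) _ hx,
    hdiv x hx, mul_zero, mul_zero]
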